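/- Let $A$ be a commutative Banach algebra (complex, with unit $1_A$). A Banach $A$-module is a complex Banach space $X$ with an $A$-module structure such that $(c1_A)x=cx$ and $\|ax\|\le\|a\|\|x\|$. A map $f$ from an open set $U$ of a Banach $A$-module to a Banach $A$-module is $A$-differentiable if it is Fréchet differentiable on $U$ and each derivative $(Df)_p$, $p\in U$, is $A$-linear. An $A$-manifold is a Hausdorff space $M$ with a system $S$ of coordinate neighborhoods: each $\varphi\in S$ is a homeomorphism from an open set $U_\varphi\subset M$ onto an open set of a Banach $A$-module $X_\varphi$, the $U_\varphi$ cover $M$, and all coordinate transformations $\psi\circ\varphi^{-1}:\varphi(U_\varphi\cap U_\psi)\to\psi(U_\varphi\cap U_\psi)$ are $A$-differentiable. A continuous map between (open subsets of) $A$-manifolds is $A$-holomorphic if it is $A$-differentiable in all coordinates. An $A$-holomorphic vector bundle over an $A$-manifold $M$ is an $A$-manifold $E$ with an $A$-holomorphic surjection $\pi:E\to M$ and a system of local trivializations, that is, open sets $U_\lambda$ covering $M$, Banach $A$-modules $X_\lambda$ and maps $\varphi_\lambda:\pi^{-1}(U_\lambda)\to X_\lambda$, such that each $(\varphi_\lambda,\pi):\pi^{-1}(U_\lambda)\to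 X_\lambda\times U_\lambda$ is $A$-biholomorphic and, for all $\lambda,\mu$ and $p\in U_\lambda\cap U_\mu$, the map $\varphi_\mu|_{\pi^{-1}(p)}\circ(\varphi_\lambda|_{\pi^{-1}(p)})^{-1}:X_\lambda\to X_\mu$ is $A$-linear. For a topological $A$-module $X$ let $A_A^k(X)$ be the $A$-module of continuous antisymmetric $A$-multilinear forms $X^k\to A$; if $X$ is a Banach $A$-module, so is $A_A^k(X)$ with the operator norm. Let $M$ be an $A$-manifold with the system $S$ of coordinate neighborhoods and let $k\ge 0$. For $p\in M$ the tangent space $T_pM$ is the quotient of the disjoint union of the $X_\varphi$ ($\varphi\in S$, $p\in U_\varphi$) by the relation that identifies $v\in X_\varphi$ with $(D(\psi\circ\varphi^{-1}))_{\varphi(p)}(v)\in X_\psi$, with the structure of a topological $A$-module for which all the induced bijections $\varphi_T|_p:T_pM\to X_\varphi$ are isomorphisms of topological $A$-modules. Let $(\wedge^kT^*)(M)=\bigsqcup_{p\in M}A_A^k(T_pM)$ with the projection $\pi$ to $M$, and for $\varphi\in S$ let $\varphi_{\wedge^kT^*}:\pi^{-1}(U_\varphi)\to A_A^k(X_\varphi)$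 be given by $(\varphi_{\wedge^kT^*}(f))(x_1,\dots,x_k)=f((\varphi_T|_p)^{-1}x_1,\dots,(\varphi_T|_p)^{-1}x_k)$ for $f\in A_A^k(T_pM)$. Then: 1. The sets $(\varphi_{\wedge^kT^*},\pi)^{-1}(G\times V)$, with $\varphi\in S$, $G\subset A_A^k(X_\varphi)$ open and $V\subset U_\varphi$ open, are an open base of a topology on $(\wedge^kT^*)(M)$, and this topology is Hausdorff. 2. With this topology $(\wedge^kT^*)(M)$ is an $A$-manifold with $\{(\varphi_{\wedge^kT^*},\varphi\circ\pi)\}_{\varphi\in S}$ as the system of coordinate neighborhoods. 3. This $A$-manifold is an $A$-holomorphic vector bundle over $M$ with projection $\pi$ and with $\{(\varphi_{\wedge^kT^*},\pi)\}_{\varphi\in S}$ as the system of local trivializations. 4. For $U\subset M$ open let $O_M(U)$ be the set of $A$-valued $A$-holomorphic maps on $U$ and $\Omega^k_M(U)$ the set of $A$-holomorphic sections of $(\wedge^kT^*)(M)$ on $U$. With the pointwise operations and the restriction of maps, $O_M$ is a sheaf of $A$-algebras and $\Omega^k_M$ is a sheaf of $O_M$-modules. -/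

import Mathlib

open Set Topology TopologicalSpace

universe u v w v₁ w₁ v₂ w₂

noncomputable section

/-! ### Banach modules over a commutative Banach algebra -/

/-- A Banach module over the (complex, unital) commutative Banach algebra `A`: a complex Banach
space with an `A`-module structure such that `(c • 1) • x = c • x` and `‖a • x‖ ≤ ‖a‖ * ‖x‖`. -/
structure BanachMod (A : Type u) [NormedCommRing A] [NormedAlgebra ℂ A] where
  carrier : Type w
  [normed : NormedAddCommGroup carrier]
  [space : NormedSpace ℂ carrier]
  [module : Module A carrier]
  [tower : IsScalarTower ℂ A carrier]
  [bounded : IsBoundedSMul A carrier]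
  [complete : CompleteSpace carrier]

namespace BanachMod

variable {A : Type u} [NormedCommRing A] [NormedAlgebra ℂ A]

instance : CoeSort (BanachMod.{u, w} A) (Type w) := ⟨BanachMod.carrier⟩

attribute [instance] BanachMod.normed BanachMod.space BanachMod.module BanachMod.tower
  BanachMod.bounded BanachMod.complete

/-- The algebra `A` as a Banach module over itself. -/
abbrev self (A : Type u) [NormedCommRing A] [NormedAlgebra ℂ A] [CompleteSpace A] :
    BanachMod.{u, u} A where
  carrier := A

/-- The product of two Banach modules, with the maximum norm. -/
abbrev prod (X : BanachMod.{u, w₁} A) (Y : BanachMod.{u, w₂} A) :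
    BanachMod.{u, max w₁ w₂} A where
  carrier := X × Y

end BanachMod

/-! ### Continuous antisymmetric forms -/

section Forms

variable (A : Type u) [NormedCommRing A]

/-- `L_A(X, …, X; A)` is the Mathlib type of continuous `A`-multilinear maps; this is its
`A`-submodule of antisymmetric forms. -/
def altSubmodule (X : Type w) [AddCommGroup X] [Module A X] [TopologicalSpace X] (k : ℕ) :
    Submodule A (ContinuousMultilinearMap A (fun _ : Fin k => X) A) where
  carrier := {f | ∀ (σ : Equiv.Perm (Fin k)) (x : Fin k → X),
    f (fun i => x (σ i)) = Equiv.Perm.sign σ • f x}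
  zero_mem' := by
    intro σ x
    simp
  add_mem' := by
    intro f g hf hg σ x
    simp [hf σ x, hg σ x]
  smul_mem' := by
    intro a f hf σ x
    simp only [smul_apply, hf σ x]
    rw [smul_comm]

/-- The `A`-module `A_A^k(X)` of continuous antisymmetric `(A, k)`-linear forms of `X`. -/
def AltForm (X : Type w) [AddCommGroup X] [Module A X] [TopologicalSpace X] (k : ℕ) :
    Type (max u w) :=
  altSubmodule A X k

namespace AltForm

variable {A}
variable {X : Type w} [AddCommGroup X] [Module A X] [TopologicalSpace X] {k : ℕ}

instance : AddCommGroup (AltForm A X k) := inferInstanceAs (AddCommGroup (altSubmodule A X k))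

instance : Module A (AltForm A X k) := inferInstanceAs (Module A (altSubmodule A X k))

/-- The underlying continuous multilinear map. -/
def toMultilinear (f : AltForm A X k) : ContinuousMultilinearMap A (fun _ : Fin k => X) A := f.1

instance : CoeFun (AltForm A X k) (fun _ => (Fin k → X) → A) := ⟨fun f => f.toMultilinear⟩

/-- The pull back `F^* f` of a form `f` along a continuous `A`-linear map `F`. -/
def pullback {Y : Type w₁} [AddCommGroup Y] [Module A Y] [TopologicalSpace Y]
    (F : X →L[A] Y) (f : AltForm A Y k) : AltForm A X k :=
  ⟨f.toMultilinear.compContinuousLinearMap (fun _ => F), fun σ x => f.2 σ (fun i => F (x i))⟩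

end AltForm

end Forms

namespace AltForm

variable {A : Type u} [NormedCommRing A] [NormedAlgebra ℂ A]

/-- A form on a Banach module, seen as a continuous `ℂ`-multilinear map. -/
def toComplex (X : BanachMod.{u, w} A) (k : ℕ) :
    AltForm A X k →+ ContinuousMultilinearMap ℂ (fun _ : Fin k => (X : Type w)) A where
  toFun f := f.toMultilinear.restrictScalars ℂ
  map_zero' := rfl
  map_add' _ _ := rfl

theorem toComplex_injective (X : BanachMod.{u, w} A) (k : ℕ) :
    Function.Injective (toComplex X k) := by
  intro f g h
  apply Subtype.ext
  ext x
  exact congrArg (fun F : ContinuousMultilinearMap ℂ (fun _ : Fin k => (X : Type w)) A => F x) h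

/-- The norm of a form on a Banach module: its operator norm as a multilinear map. -/
instance (X : BanachMod.{u, w} A) (k : ℕ) : NormedAddCommGroup (AltForm A X k) :=
  NormedAddCommGroup.induced _ _ (toComplex X k) (toComplex_injective X k)

theorem norm_def (X : BanachMod.{u, w} A) (k : ℕ) (f : AltForm A X k) :
    ‖f‖ = ‖toComplex X k f‖ := rfl

instance (X : BanachMod.{u, w} A) (k : ℕ) : IsBoundedSMul A (AltForm A X k) :=
  IsBoundedSMul.of_norm_smul_le (α := A) (β := AltForm A X k) fun a f => by
    rw [norm_def, norm_def]
    refine ContinuousMultilinearMap.opNorm_le_bound (by positivity) fun x => ?_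
    calc ‖a * toComplex X k f x‖ ≤ ‖a‖ * ‖toComplex X k f x‖ := norm_mul_le _ _
      _ ≤ ‖a‖ * (‖toComplex X k f‖ * ∏ i, ‖x i‖) := by
          gcongr
          exact (toComplex X k f).le_opNorm x
      _ = _ := by ring

instance (X : BanachMod.{u, w} A) (k : ℕ) : Module ℂ (AltForm A X k) :=
  Module.compHom _ (algebraMap ℂ A)

instance (X : BanachMod.{u, w} A) (k : ℕ) : IsScalarTower ℂ A (AltForm A X k) :=
  ⟨fun c a f => by
    change (c • a) • f = algebraMap ℂ A c • (a • f)
    rw [smul_smul, Algebra.smul_def]⟩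

instance (X : BanachMod.{u, w} A) (k : ℕ) : NormedSpace ℂ (AltForm A X k) where
  norm_smul_le c f := by
    have h : toComplex X k (c • f) = c • toComplex X k f := by
      ext x
      change algebraMap ℂ A c * toComplex X k f x = c • toComplex X k f x
      rw [Algebra.smul_def]
    rw [norm_def, norm_def, h]
    exact norm_smul_le c (toComplex X k f)

theorem toComplex_range (X : BanachMod.{u, w} A) (k : ℕ) :
    range (toComplex X k) =
      {F | (∀ (m : Fin k → X) (i : Fin k) (a : A) (x : X),
          F (Function.update m i (a • x)) = a * F (Function.update m i x)) ∧
        ∀ (σ : Equiv.Perm (Fin k)) (x : Fin k → X),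
          F (fun i => x (σ i)) = Equiv.Perm.sign σ • F x} := by
  ext F
  constructor
  · rintro ⟨f, rfl⟩
    exact ⟨fun m i a x => f.toMultilinear.map_update_smul m i a x, f.2⟩
  · rintro ⟨h₁, h₂⟩
    refine ⟨⟨{ toFun := F
               map_update_add' := fun {inst} m i x y => ?_
               map_update_smul' := fun {inst} m i a x => ?_
               cont := F.cont }, h₂⟩, ?_⟩
    · exact F.map_update_add' m i x y
    · have : inst = instDecidableEqFin k := Subsingleton.elim _ _
      subst this
      exact h₁ m i a x
    · ext x
      rfl

instance (X : BanachMod.{u, w} A) (k : ℕ) [CompleteSpace A] : CompleteSpace (AltForm A X k) := by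
  have hu : IsUniformInducing (toComplex X k) := ⟨rfl⟩
  rw [completeSpace_iff_isComplete_range hu, toComplex_range]
  apply IsClosed.isComplete
  have he : ∀ x : Fin k → X, Continuous
      fun F : ContinuousMultilinearMap ℂ (fun _ : Fin k => (X : Type w)) A => F x :=
    fun x => continuous_eval_const x
  simp only [ofPred_and, ofPred_forall]
  refine IsClosed.inter ?_ ?_
  · refine isClosed_iInter fun m => isClosed_iInter fun i => isClosed_iInter fun a =>
      isClosed_iInter fun x => ?_
    exact isClosed_eq (he _) (continuous_const.mul (he _))
  · refine isClosed_iInter fun σ => isClosed_iInter fun x => ?_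
    exact isClosed_eq (he _) ((he _).const_smul _)

/-- `A_A^k(X)` as a Banach module, for a Banach module `X`. -/
abbrev banach [CompleteSpace A] (X : BanachMod.{u, w} A) (k : ℕ) : BanachMod.{u, max u w} A where
  carrier := AltForm A X k

end AltForm

/-! ### Manifolds and holomorphic maps -/

section Manifolds

variable {A : Type u} [NormedCommRing A] [NormedAlgebra ℂ A]

/-- `f` is `A`-differentiable on (the open set) `U`: it is Fréchet differentiable there and its
derivatives are `A`-linear. -/
def ADifferentiableOn {X : BanachMod.{u, w₁} A} {Y : BanachMod.{u, w₂} A} (f : X → Y)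
    (U : Set X) : Prop :=
  ∀ z ∈ U, DifferentiableAt ℂ f z ∧
    ∀ (a : A) (h : X), fderiv ℂ f z (a • h) = a • fderiv ℂ f z h

variable (A) in
/-- The data of a coordinate neighbourhood: a bijection from a subset of `M` to a subset of a
Banach module. -/
structure AChart (M : Type v) where
  Model : BanachMod.{u, w} A
  toPartialEquiv : PartialEquiv M Model

namespace AChart

variable {M : Type v} (φ : AChart.{u, v, w} A M)

instance : CoeFun (AChart.{u, v, w} A M) (fun φ => M → φ.Model) := ⟨fun φ => φ.toPartialEquiv⟩

/-- The domain `U_φ`. -/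
abbrev source : Set M := φ.toPartialEquiv.source

/-- The image `φ(U_φ)`. -/
abbrev target : Set φ.Model := φ.toPartialEquiv.target

/-- The inverse map. -/
abbrev symm : φ.Model → M := φ.toPartialEquiv.symm

/-- `φ` is a homeomorphism from an open set of `M` to an open set of its Banach module. -/
structure IsOpenHomeo [TopologicalSpace M] : Prop where
  isOpen_source : IsOpen φ.source
  isOpen_target : IsOpen φ.target
  continuousOn : ContinuousOn φ φ.source
  continuousOn_symm : ContinuousOn φ.symm φ.target

/-- The product of two charts. -/
abbrev prod {N : Type v₂} (ψ : AChart.{u, v₂, w₂} A N) : AChart.{u, max v v₂, max w w₂} A (M × N) where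
  Model := φ.Model.prod ψ.Model
  toPartialEquiv := φ.toPartialEquiv.prod ψ.toPartialEquiv

end AChart

/-- The identity of a Banach module, as a chart. -/
abbrev BanachMod.idChart (X : BanachMod.{u, w} A) : AChart.{u, w, w} A X where
  Model := X
  toPartialEquiv := PartialEquiv.refl X

/-- The topological space `M` is an `A`-manifold with the system `S` of coordinate
neighbourhoods. -/
structure IsAManifold {M : Type v} [TopologicalSpace M] {ι : Type v₁}
    (S : ι → AChart.{u, v, w} A M) : Prop where
  t2 : T2Space M
  homeo : ∀ i, (S i).IsOpenHomeo
  cover : ∀ p, ∃ i, p ∈ (S i).source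
  compat : ∀ i j, ADifferentiableOn (S j ∘ (S i).symm) (S i '' ((S i).source ∩ (S j).source))

/-- The map `f : U → M₂`, where `U` is an (open) subset of `M₁`, is `A`-holomorphic with respect to
the systems of coordinate neighbourhoods `S₁` and `S₂`: it is continuous, and in all coordinates
`φ₁ = S₁ i` and `φ₂ = S₂ j` the map `φ₂ ∘ f ∘ φ₁⁻¹ : φ₁(U₁ ∩ f⁻¹(U₂)) → X₂` (which is the unique `g`
below, restricted to that set) is `A`-differentiable. -/
def AHolomorphic {M₁ : Type v₁} [TopologicalSpace M₁] {ι₁ : Type*}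
    (S₁ : ι₁ → AChart.{u, v₁, w₁} A M₁)
    {M₂ : Type v₂} [TopologicalSpace M₂] {ι₂ : Type*} (S₂ : ι₂ → AChart.{u, v₂, w₂} A M₂)
    {U : Set M₁} (f : U → M₂) : Prop :=
  Continuous f ∧ ∀ i j, ∃ g : (S₁ i).Model → (S₂ j).Model,
    (∀ p : U, (p : M₁) ∈ (S₁ i).source → f p ∈ (S₂ j).source → g (S₁ i p) = S₂ j (f p)) ∧
    ADifferentiableOn g {z | ∃ p : U, (p : M₁) ∈ (S₁ i).source ∧ f p ∈ (S₂ j).source ∧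
      S₁ i p = z}

/-- The bijection `e` between (open) subsets of two `A`-manifolds is `A`-biholomorphic. -/
def ABiholomorphic {M₁ : Type v₁} [TopologicalSpace M₁] {ι₁ : Type*}
    (S₁ : ι₁ → AChart.{u, v₁, w₁} A M₁)
    {M₂ : Type v₂} [TopologicalSpace M₂] {ι₂ : Type*} (S₂ : ι₂ → AChart.{u, v₂, w₂} A M₂)
    {U₁ : Set M₁} {U₂ : Set M₂} (e : U₁ ≃ U₂) : Prop :=
  AHolomorphic S₁ S₂ (fun x => (e x : M₂)) ∧ AHolomorphic S₂ S₁ (fun y => (e.symm y : M₁))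

variable (A) in
/-- The data of a local trivialization of `E` over `M`: the set `U_λ`, the Banach module `X_λ` and
the map `φ_λ` (of which only the values on the preimage of `U_λ` matter). -/
structure LocalTriv (E : Type v₁) (M : Type v₂) where
  base : Set M
  Model : BanachMod.{u, w} A
  toFun : E → Model

/-- `π : E → M` is an `A`-holomorphic vector bundle with the local trivializations `T`, where `E`
and `M` carry the systems of coordinate neighbourhoods `SE` and `SM`. -/
structure IsAHolomorphicVectorBundle {E : Type v₁} [TopologicalSpace E] {ιE : Type*}
    (SE : ιE → AChart.{u, v₁, w₁} A E) {M : Type v₂} [TopologicalSpace M] {ιM : Type*}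
    (SM : ιM → AChart.{u, v₂, w₂} A M) (π : E → M) {Λ : Type*}
    (T : Λ → LocalTriv.{u, w, v₁, v₂} A E M) : Prop where
  total : IsAManifold SE
  base : IsAManifold SM
  proj_holomorphic : AHolomorphic SE SM (U := univ) (fun x => π x)
  proj_surjective : Function.Surjective π
  isOpen_base : ∀ l, IsOpen (T l).base
  cover : ⋃ l, (T l).base = univ
  biholomorphic : ∀ l, ∃ e : (π ⁻¹' (T l).base) ≃ ((univ ×ˢ (T l).base : Set ((T l).Model × M))),
    (∀ x, (e x : (T l).Model × M) = ((T l).toFun x, π x)) ∧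
    ABiholomorphic SE (fun i => (T l).Model.idChart.prod (SM i)) e
  linear : ∀ l m, ∀ p ∈ (T l).base ∩ (T m).base, ∃ L : (T l).Model →ₗ[A] (T m).Model,
    ∀ x, π x = p → (T m).toFun x = L ((T l).toFun x)

end Manifolds

/-! ### The tangent space -/

section Tangent

variable {A : Type u} [NormedCommRing A] [NormedAlgebra ℂ A]
  {M : Type v} [TopologicalSpace M] {ι : Type v₁} {S : ι → AChart.{u, v, w} A M}

/-- The derivative `(D(φⱼ ∘ φᵢ⁻¹))_{φᵢ(p)}`. -/
def transD (S : ι → AChart.{u, v, w} A M) (p : M) (i j : ι) : (S i).Model →L[ℂ] (S j).Model :=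
  fderiv ℂ (S j ∘ (S i).symm) (S i p)

theorem transD_self (hS : IsAManifold S) {p : M} {i : ι} (hi : p ∈ (S i).source) :
    transD S p i i = ContinuousLinearMap.id ℂ _ := by
  have h : (S i ∘ (S i).symm) =ᶠ[𝓝 (S i p)] id := by
    filter_upwards [(hS.homeo i).isOpen_target.mem_nhds ((S i).toPartialEquiv.map_source hi)]
      with z hz
    exact (S i).toPartialEquiv.right_inv hz
  unfold transD
  rw [h.fderiv_eq, fderiv_id]

theorem transD_comp (hS : IsAManifold S) {p : M} {i j l : ι} (hi : p ∈ (S i).source)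
    (hj : p ∈ (S j).source) (hl : p ∈ (S l).source) (x : (S i).Model) :
    transD S p j l (transD S p i j x) = transD S p i l x := by
  have hp : (S i).symm (S i p) = p := (S i).toPartialEquiv.left_inv hi
  have ht : S i p ∈ (S i).target := (S i).toPartialEquiv.map_source hi
  have hc : ContinuousAt (S i).symm (S i p) :=
    (hS.homeo i).continuousOn_symm.continuousAt ((hS.homeo i).isOpen_target.mem_nhds ht)
  have h : (S l ∘ (S i).symm) =ᶠ[𝓝 (S i p)] (S l ∘ (S j).symm) ∘ (S j ∘ (S i).symm) := by
    have hm : (S j).source ∈ 𝓝 ((S i).symm (S i p)) := by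
      rw [hp]
      exact (hS.homeo j).isOpen_source.mem_nhds hj
    filter_upwards [hc hm] with z hz
    have := (S j).toPartialEquiv.left_inv hz
    exact congrArg (S l) this.symm
  have hpt : (S j ∘ (S i).symm) (S i p) = S j p := congrArg (S j) hp
  have h₁ := (hS.compat i j (S i p) ⟨p, ⟨hi, hj⟩, rfl⟩).1
  have h₂ := (hS.compat j l (S j p) ⟨p, ⟨hj, hl⟩, rfl⟩).1
  rw [← hpt] at h₂
  have h₃ := fderiv_comp (S i p) h₂ h₁
  unfold transD
  rw [h.fderiv_eq, h₃, hpt]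
  rfl

/-- The equivalence relation on the (disjoint) union of the Banach modules of the charts at `p`
that identifies vectors corresponding to each other under the derivatives of the coordinate
transformations. -/
def tangentSetoid (hS : IsAManifold S) (p : M) :
    Setoid (Σ i : {i // p ∈ (S i).source}, (S i.1).Model) where
  r x y := y.2 = transD S p x.1 y.1 x.2
  iseqv :=
    { refl := fun x => by rw [transD_self hS x.1.2]; rfl
      symm := fun {x y} h => by
        rw [h, transD_comp hS x.1.2 y.1.2 x.1.2, transD_self hS x.1.2]
        rfl
      trans := fun {x y z} h₁ h₂ => by
        rw [h₂, h₁, transD_comp hS x.1.2 y.1.2 z.1.2] }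

/-- The tangent space `T_p(M)`. -/
def TangentSp (hS : IsAManifold S) (p : M) : Type (max v₁ w) := Quotient (tangentSetoid hS p)

namespace TangentSp

variable (hS : IsAManifold S) (p : M)

/-- The tangent space carries the quotient topology. -/
instance : TopologicalSpace (TangentSp hS p) :=
  inferInstanceAs (TopologicalSpace (Quotient (tangentSetoid hS p)))

variable {p}

/-- The bijection `φ_T|_p` of `T_p(M)` with the Banach module of the chart `φ` at `p`. -/
def coord {i : ι} (hi : p ∈ (S i).source) : TangentSp hS p ≃ (S i).Model where
  toFun := Quotient.lift (fun x => transD S p x.1 i x.2) fun x y (h : y.2 = _) => by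
    rw [h, transD_comp hS x.1.2 y.1.2 hi]
  invFun x := Quotient.mk _ ⟨⟨i, hi⟩, x⟩
  left_inv t := by
    induction t using Quotient.ind with
    | _ x =>
      refine Quotient.sound ?_
      change x.2 = transD S p i x.1 (transD S p x.1 i x.2)
      rw [transD_comp hS x.1.2 hi x.1.2, transD_self hS x.1.2]
      rfl
  right_inv x := by
    change transD S p i i x = x
    rw [transD_self hS hi]
    rfl

theorem coord_symm_coord {i j : ι} (hi : p ∈ (S i).source) (hj : p ∈ (S j).source)
    (x : (S i).Model) : coord hS hj ((coord hS hi).symm x) = transD S p i j x := rfl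

theorem transD_coord {i j : ι} (hi : p ∈ (S i).source) (hj : p ∈ (S j).source)
    (t : TangentSp hS p) : transD S p i j (coord hS hi t) = coord hS hj t := by
  rw [← coord_symm_coord hS hi hj, Equiv.symm_apply_apply]

variable (p) in
/-- A chosen chart at `p`, used only to define the algebraic operations. -/
def ix : ι := (hS.cover p).choose

theorem ix_mem : p ∈ (S (ix hS p)).source := (hS.cover p).choose_spec

/-- The operations of `T_p(M)` are transported from the Banach module of a chart at `p`; by
`coordL` below, the choice of the chart does not matter. -/
instance : AddCommGroup (TangentSp hS p) := (coord hS (ix_mem hS)).addCommGroup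

instance : Module A (TangentSp hS p) := (coord hS (ix_mem hS)).module A

theorem transD_smul (hS : IsAManifold S) {i j : ι} (hi : p ∈ (S i).source) (hj : p ∈ (S j).source) (a : A)
    (x : (S i).Model) : transD S p i j (a • x) = a • transD S p i j x :=
  (hS.compat i j (S i p) ⟨p, ⟨hi, hj⟩, rfl⟩).2 a x

/-- For each chart `φ` at `p`, the bijection `φ_T|_p` is an isomorphism of topological
`A`-modules. -/
def coordL {i : ι} (hi : p ∈ (S i).source) : TangentSp hS p ≃L[A] (S i).Model where
  toFun := coord hS hi
  invFun := (coord hS hi).symm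
  left_inv := (coord hS hi).left_inv
  right_inv := (coord hS hi).right_inv
  map_add' s t := by
    rw [← transD_coord hS (ix_mem hS) hi, ← transD_coord hS (ix_mem hS) hi s,
      ← transD_coord hS (ix_mem hS) hi t, ← map_add]
    exact congrArg _ (Equiv.apply_symm_apply _ _)
  map_smul' a t := by
    rw [← transD_coord hS (ix_mem hS) hi, ← transD_coord hS (ix_mem hS) hi t, RingHom.id_apply,
      ← transD_smul hS (ix_mem hS) hi]
    exact congrArg _ (Equiv.apply_symm_apply _ _)
  continuous_toFun :=
    continuous_quot_lift _ (continuous_sigma fun j => (transD S p j.1 i).continuous)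
  continuous_invFun :=
    (continuous_quotient_mk' (s := tangentSetoid hS p)).comp
      (continuous_sigmaMk (σ := fun j : {j // p ∈ (S j).source} => ((S j.1).Model : Type w))
        (i := ⟨i, hi⟩))

end TangentSp

end Tangent

/-! ### The cotangent exterior bundle -/

section Cotangent

variable {A : Type u} [NormedCommRing A] [NormedAlgebra ℂ A]
  {M : Type v} [TopologicalSpace M] {ι : Type v₁} {S : ι → AChart.{u, v, w} A M}

/-- The cotangent exterior space `A_A^k(T_p(M))`. -/
abbrev CotangentSp (hS : IsAManifold S) (k : ℕ) (p : M) : Type (max u v₁ w) :=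
  AltForm A (TangentSp hS p) k

/-- The cotangent exterior bundle: the disjoint union of the spaces `A_A^k(T_p(M))`. -/
structure CotangentBundle (hS : IsAManifold S) (k : ℕ) where
  proj : M
  form : CotangentSp hS k proj

namespace CotangentBundle

variable (hS : IsAManifold S) (k : ℕ)

open Classical in
/-- The map `φ_{∧^k T^*}` on the preimage of `U_φ` (and `0` elsewhere): it sends the form `f` at
`p` to the form `(x₁, …, x_k) ↦ f((φ_T|_p)⁻¹ x₁, …, (φ_T|_p)⁻¹ x_k)`. -/
def fiberCoord (i : ι) (ω : CotangentBundle hS k) : AltForm A (S i).Model k :=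
  if hi : ω.proj ∈ (S i).source then
    AltForm.pullback ((TangentSp.coordL hS hi).symm : (S i).Model →L[A] TangentSp hS ω.proj) ω.form
  else 0

open Classical in
/-- The form at `p ∈ U_φ` with a given value of `φ_{∧^k T^*}` (and `0` at the other points). -/
def ofFiberCoord (i : ι) (p : M) (h : AltForm A (S i).Model k) : CotangentBundle hS k :=
  ⟨p, if hi : p ∈ (S i).source then
    AltForm.pullback (TangentSp.coordL hS hi : TangentSp hS p →L[A] (S i).Model) h else 0⟩

theorem ofFiberCoord_fiberCoord (i : ι) (ω : CotangentBundle hS k) (hi : ω.proj ∈ (S i).source) :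
    ofFiberCoord hS k i ω.proj (fiberCoord hS k i ω) = ω := by
  obtain ⟨p, f⟩ := ω
  replace hi : p ∈ (S i).source := hi
  simp only [ofFiberCoord, fiberCoord, dif_pos hi]
  congr 1
  apply Subtype.ext
  ext x
  change f.toMultilinear (fun l => _) = f.toMultilinear x
  congr 1
  funext l
  exact (TangentSp.coordL hS hi).symm_apply_apply (x l)

theorem fiberCoord_ofFiberCoord (i : ι) (p : M) (hi : p ∈ (S i).source)
    (h : AltForm A (S i).Model k) : fiberCoord hS k i (ofFiberCoord hS k i p h) = h := by
  have h₁ : ofFiberCoord hS k i p h = ⟨p, AltForm.pullback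
      (TangentSp.coordL hS hi : TangentSp hS p →L[A] (S i).Model) h⟩ := by
    simp only [ofFiberCoord, dif_pos hi]
  rw [h₁]
  simp only [fiberCoord, dif_pos hi]
  apply Subtype.ext
  ext x
  change h.toMultilinear (fun l => _) = h.toMultilinear x
  congr 1
  funext l
  exact (TangentSp.coordL hS hi).apply_symm_apply (x l)

/-- The family of sets `(φ_{∧^k T^*}, π)⁻¹(G × V)`, for `φ` a chart, `G` an open set of
`A_A^k(X_φ)` and `V` an open subset of `U_φ`. -/
def openBase : Set (Set (CotangentBundle hS k)) :=
  {W | ∃ (i : ι) (G : Set (AltForm A (S i).Model k)) (V : Set M), IsOpen G ∧ IsOpen V ∧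
    V ⊆ (S i).source ∧ W = {ω | fiberCoord hS k i ω ∈ G ∧ ω.proj ∈ V}}

instance : TopologicalSpace (CotangentBundle hS k) := generateFrom (openBase hS k)

/-- The chart `(φ_{∧^k T^*}, φ ∘ π)` of the cotangent exterior bundle that is induced by the
chart `φ`. -/
abbrev chart [CompleteSpace A] (i : ι) :
    AChart.{u, max u v v₁ w, max u w} A (CotangentBundle hS k) where
  Model := (AltForm.banach (S i).Model k).prod (S i).Model
  toPartialEquiv :=
    { toFun := fun ω => (fiberCoord hS k i ω, S i ω.proj)
      invFun := fun z => ofFiberCoord hS k i ((S i).symm z.2) z.1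
      source := {ω | ω.proj ∈ (S i).source}
      target := {z | z.2 ∈ (S i).target}
      map_source' := fun ω hω => (S i).toPartialEquiv.map_source hω
      map_target' := fun z hz => (S i).toPartialEquiv.map_target hz
      left_inv' := fun ω hω => by
        have h : (S i).symm (S i ω.proj) = ω.proj := (S i).toPartialEquiv.left_inv hω
        change ofFiberCoord hS k i ((S i).symm (S i ω.proj)) (fiberCoord hS k i ω) = ω
        rw [h]
        exact ofFiberCoord_fiberCoord hS k i ω hω
      right_inv' := fun z hz =>
        Prod.ext (fiberCoord_ofFiberCoord hS k i _ ((S i).toPartialEquiv.map_target hz) z.1)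
          ((S i).toPartialEquiv.right_inv hz) }

/-- The local trivialization `(φ_{∧^k T^*}, π)` of the cotangent exterior bundle that is induced by
the chart `φ`. -/
abbrev localTriv [CompleteSpace A] (i : ι) :
    LocalTriv.{u, max u w, max u v v₁ w, v} A (CotangentBundle hS k) M where
  base := (S i).source
  Model := AltForm.banach (S i).Model k
  toFun := fiberCoord hS k i

end CotangentBundle

end Cotangent

/-! ### Sheaves of sections -/

section Sheaves

variable {M : Type v} [TopologicalSpace M]

/-- The sets `P U` of (dependent) functions on the open sets `U` form a sheaf under the restriction
of functions. -/
structure IsSheafOfSections {F : M → Type w} (P : ∀ U : Opens M, Set (∀ p : U, F p)) : Prop where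
  restrict : ∀ {U V : Opens M} (h : V ≤ U) (s : ∀ p : U, F p), s ∈ P U →
    (fun p : V => s ⟨p, h p.2⟩) ∈ P V
  glue : ∀ {κ : Type v} (U : κ → Opens M) (s : ∀ (a : κ) (p : U a), F p), (∀ a, s a ∈ P (U a)) →
    (∀ (a b : κ) (p : M) (ha : p ∈ U a) (hb : p ∈ U b), s a ⟨p, ha⟩ = s b ⟨p, hb⟩) →
    ∃! t : ∀ p : (⨆ a, U a : Opens M), F p, t ∈ P (⨆ a, U a) ∧
      ∀ (a : κ) (p : M) (ha : p ∈ U a), t ⟨p, le_iSup U a ha⟩ = s a ⟨p, ha⟩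

variable {A : Type u} [NormedCommRing A]

/-- Under the pointwise operations, the sets `O U` of `A`-valued functions on the open sets `U` form
a sheaf of `A`-algebras, and the sets `Ω U` of sections of the `A`-modules `F p` form a sheaf of
modules on it. -/
structure IsSheafOfModules (O : ∀ U : Opens M, Set (U → A)) {F : M → Type w}
    [∀ p, AddCommGroup (F p)] [∀ p, Module A (F p)] (Ω : ∀ U : Opens M, Set (∀ p : U, F p)) :
    Prop where
  ring_sheaf : IsSheafOfSections (F := fun _ => A) O
  const_mem : ∀ (U : Opens M) (c : A), (fun _ => c) ∈ O U
  ring_add : ∀ (U : Opens M) (f g : U → A), f ∈ O U → g ∈ O U → (fun p => f p + g p) ∈ O U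
  ring_mul : ∀ (U : Opens M) (f g : U → A), f ∈ O U → g ∈ O U → (fun p => f p * g p) ∈ O U
  sheaf : IsSheafOfSections Ω
  zero_mem : ∀ U : Opens M, (fun _ => 0) ∈ Ω U
  add_mem : ∀ (U : Opens M) (s t : ∀ p : U, F p), s ∈ Ω U → t ∈ Ω U → (fun p => s p + t p) ∈ Ω U
  smul_mem : ∀ (U : Opens M) (f : U → A) (s : ∀ p : U, F p), f ∈ O U → s ∈ Ω U →
    (fun p => f p • s p) ∈ Ω U

variable [NormedAlgebra ℂ A] [CompleteSpace A] {ι : Type v₁}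

/-- `O_M(U)`: the `A`-valued `A`-holomorphic maps on `U`. -/
def holomorphicFunctions (S : ι → AChart.{u, v, w} A M) (U : Opens M) : Set (U → A) :=
  {f | AHolomorphic S (fun _ : Unit => (BanachMod.self A).idChart) (U := (U : Set M)) f}

/-- `Ω^k_M(U)`: the `A`-holomorphic differential `k`-forms on `U`, that is, the `A`-holomorphic
sections on `U` of the cotangent exterior bundle. -/
def holomorphicForms {S : ι → AChart.{u, v, w} A M} (hS : IsAManifold S) (k : ℕ) (U : Opens M) :
    Set (∀ p : U, CotangentSp hS k (p : M)) :=
  {s | AHolomorphic S (CotangentBundle.chart hS k) (U := (U : Set M))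
    (fun p => (⟨p, s p⟩ : CotangentBundle hS k))}

end Sheaves

end

/-! A form at a point has one coordinate expression in each chart; two of them differ by the pull
back along the derivative `D(φ ∘ ψ⁻¹)` of a coordinate transformation. Hence everything rests on the
regularity of that derivative. Cauchy estimates bound the difference quotients and the remainder of
the first order Taylor expansion uniformly near a point, so that a holomorphic map between Banach
spaces has a derivative that is holomorphic in each direction (as a locally uniform limit of
difference quotients) and then in the operator norm. The second derivative of an `A`-differentiable
map is `A`-linear in the last argument, and by symmetry in the first one, so the derivative is
`A`-differentiable in each direction; since forms are `A`-multilinear, so is the pull back.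

A continuous map of `A`-manifolds is `A`-holomorphic near a point as soon as it is
`A`-differentiable in one pair of charts there. This reduces the bundle conditions to identities and
projections, and it makes holomorphy a condition on germs, which gives the sheaf property.
-/

section Holomorphy

open Asymptotics Filter Metric

theorem exists_ball_forall_ball_subset {X : Type*} [PseudoMetricSpace X] {U : Set X} {x : X}
    (hU : IsOpen U) (hx : x ∈ U) : ∃ r > 0, ∀ y ∈ ball x r, ball y r ⊆ U := by
  obtain ⟨R, hR, hRU⟩ := Metric.isOpen_iff.1 hU x hx
  exact ⟨R / 2, half_pos hR, fun y hy =>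
    (ball_subset_ball' (by linarith [mem_ball.1 hy])).trans hRU⟩

theorem exists_ball_forall_norm_le {X Y : Type*} [PseudoMetricSpace X] [SeminormedAddCommGroup Y]
    {f : X → Y} {U : Set X} {x : X} (hU : IsOpen U) (hf : ContinuousOn f U) (hx : x ∈ U) :
    ∃ r > 0, ∃ C, ∀ y ∈ ball x r, ball y r ⊆ U ∧ ∀ y' ∈ ball y r, ‖f y'‖ ≤ C := by
  obtain ⟨r, hr, hball⟩ := exists_ball_forall_ball_subset
    (hf.norm.isOpen_inter_preimage hU isOpen_Iio) ⟨hx, lt_add_one ‖f x‖⟩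
  exact ⟨r, hr, ‖f x‖ + 1, fun y hy =>
    ⟨(hball y hy).trans inter_subset_left, fun y' hy' => (hball y hy hy').2.le⟩⟩

variable {E F : Type*} [NormedAddCommGroup E] [NormedSpace ℂ E] [NormedAddCommGroup F]
  [NormedSpace ℂ F] {f : E → F} {U : Set E} {z : E} {r C : ℝ}

theorem norm_fderiv_le_of_forall_mem_ball_norm_le (hf : DifferentiableOn ℂ f (ball z r))
    (hr : 0 < r) (hC : ∀ w ∈ ball z r, ‖f w‖ ≤ C) : ‖fderiv ℂ f z‖ ≤ 2 * C / r := by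
  refine Complex.norm_fderiv_le_div_of_mapsTo_ball hf (fun w hw => ?_) hr
  rw [mem_closedBall_iff_norm]
  linarith [norm_sub_le (f w) (f z), hC w hw, hC z (mem_ball_self hr)]

theorem norm_sub_sub_fderiv_le (hf : DifferentiableOn ℂ f (ball z r))
    (hC : ∀ w ∈ ball z r, ‖f w‖ ≤ C) {w : E} (hw : w ∈ ball z r) :
    ‖f w - f z - fderiv ℂ f z (w - z)‖ ≤ 4 * C * (‖w - z‖ / r) ^ 2 := by
  have hr : 0 < r := pos_of_mem_ball hw
  set g : E → F := fun w => f w - f z - fderiv ℂ f z (w - z) with hg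
  have hgz : g z = 0 := by simp [hg]
  have hgd : DifferentiableOn ℂ g (ball z r) := by fun_prop
  have hmaps : MapsTo g (ball z r) (closedBall (g z) (4 * C)) := fun w hw => by
    have hD : ‖fderiv ℂ f z (w - z)‖ ≤ 2 * C := calc
      _ ≤ 2 * C / r * r := (fderiv ℂ f z).le_of_opNorm_le_of_le
          (norm_fderiv_le_of_forall_mem_ball_norm_le hf hr hC) (mem_ball_iff_norm.1 hw).le
      _ = 2 * C := div_mul_cancel₀ _ hr.ne'
    rw [hgz, mem_closedBall_zero_iff]
    linarith [norm_sub_le (f w - f z) (fderiv ℂ f z (w - z)), norm_sub_le (f w) (f z), hC w hw,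
      hC z (mem_ball_self hr)]
  have hlittle : (fun w => g w - g z) =o[𝓝 z] fun w => ‖w - z‖ ^ 1 := by
    simp only [hgz, sub_zero, pow_one, isLittleO_norm_right]
    exact (hf.differentiableAt (ball_mem_nhds z hr)).hasFDerivAt.isLittleO
  have := Complex.dist_le_mul_div_pow_of_mapsTo_ball_of_isLittleO hgd hmaps hlittle hw
  rwa [hgz, dist_zero_right, dist_eq_norm] at this

theorem uniformCauchySeqOn_fderiv {ι : Type*} {l : Filter ι} {G : ι → E → F} (hr : 0 < r)
    {V : Set E} (hV : ∀ w ∈ V, ball w r ⊆ U) (hG : ∀ᶠ n in l, DifferentiableOn ℂ (G n) U)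
    (hcauchy : UniformCauchySeqOn G l U) : UniformCauchySeqOn (fun n => fderiv ℂ (G n)) l V := by
  intro u hu
  obtain ⟨ε, hε, hεu⟩ := Metric.mem_uniformity_dist.1 hu
  have hd : ∀ᶠ m in l ×ˢ l, DifferentiableOn ℂ (G m.1) U ∧ DifferentiableOn ℂ (G m.2) U :=
    hG.prod_mk hG
  filter_upwards [hd, hcauchy _ (Metric.dist_mem_uniformity (by positivity : 0 < ε * r / 4))]
    with ⟨m, n⟩ ⟨hm, hn⟩ hmn w hw
  have hat : ∀ {h : E → F}, DifferentiableOn ℂ h U → DifferentiableAt ℂ h w := fun hh =>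
    (hh.mono (hV w hw)).differentiableAt (ball_mem_nhds w hr)
  have hle : ‖fderiv ℂ (G m - G n) w‖ ≤ 2 * (ε * r / 4) / r :=
    norm_fderiv_le_of_forall_mem_ball_norm_le ((hm.sub hn).mono (hV w hw)) hr fun w' hw' => by
      simpa only [Pi.sub_apply, dist_eq_norm] using (hmn w' (hV w hw hw')).le
  apply hεu
  rw [dist_eq_norm, ← fderiv_sub (hat hm) (hat hn)]
  calc _ ≤ 2 * (ε * r / 4) / r := hle
    _ = ε / 2 := by field_simp; ring
    _ < ε := half_lt_self hε

theorem differentiableOn_of_tendstoUniformlyOn [CompleteSpace F] {ι : Type*} {l : Filter ι}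
    [l.NeBot] {G : ι → E → F} (hU : IsOpen U) (hG : ∀ᶠ n in l, DifferentiableOn ℂ (G n) U)
    (hf : TendstoUniformlyOn G f l U) : DifferentiableOn ℂ f U := by
  intro z hz
  obtain ⟨r, hr, hball⟩ := exists_ball_forall_ball_subset hU hz
  have hcauchy := uniformCauchySeqOn_fderiv hr hball hG
    hf.uniformCauchySeqOn
  choose! f' hf' using fun w hw => CompleteSpace.complete (hcauchy.cauchy_map (x := w) hw)
  have hlim : TendstoUniformlyOnFilter (fun n => fderiv ℂ (G n)) f' l (𝓝 z) :=
    (hcauchy.tendstoUniformlyOn_of_tendsto hf').tendstoUniformlyOnFilter.mono_right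
      (le_principal_iff.2 (ball_mem_nhds z hr))
  have hderiv : ∀ᶠ n : ι × E in l ×ˢ 𝓝 z, HasFDerivAt (G n.1) (fderiv ℂ (G n.1) n.2) n.2 := by
    filter_upwards [hG.prod_mk (hU.eventually_mem hz)] with n hn
    exact (hn.1.differentiableAt (hU.mem_nhds hn.2)).hasFDerivAt
  have hpt : ∀ᶠ w in 𝓝 z, Tendsto (fun n => G n w) l (𝓝 (f w)) :=
    (hU.eventually_mem hz).mono fun w hw => hf.tendsto_at hw
  exact (hasFDerivAt_of_tendstoUniformlyOnFilter hlim hderiv hpt).differentiableAt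
    |>.differentiableWithinAt

theorem norm_slope_sub_fderiv_le (hf : DifferentiableOn ℂ f (ball z r))
    (hC : ∀ w ∈ ball z r, ‖f w‖ ≤ C) {v : E} {t : ℂ} (ht : t ≠ 0) (htr : ‖t • v‖ < r) :
    ‖t⁻¹ • (f (z + t • v) - f z) - fderiv ℂ f z v‖ ≤ 4 * C * (‖v‖ / r) ^ 2 * ‖t‖ := by
  have hle := norm_sub_sub_fderiv_le hf hC (w := z + t • v) (by simpa using htr)
  rw [add_sub_cancel_left] at hle
  calc _ = ‖t⁻¹ • (f (z + t • v) - f z - fderiv ℂ f z (t • v))‖ := by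
        rw [map_smul, smul_sub _ (_ - _), inv_smul_smul₀ ht]
    _ ≤ ‖t‖⁻¹ * (4 * C * (‖t • v‖ / r) ^ 2) := by rw [norm_smul, norm_inv]; gcongr
    _ = 4 * C * (‖v‖ / r) ^ 2 * ‖t‖ := by
        have : ‖t‖ ≠ 0 := norm_ne_zero_iff.2 ht
        rw [norm_smul]
        field_simp

theorem differentiableAt_fderiv_apply [CompleteSpace F] (hU : IsOpen U)
    (hf : DifferentiableOn ℂ f U) (hz : z ∈ U) (v : E) :
    DifferentiableAt ℂ (fun w => fderiv ℂ f w v) z := by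
  obtain ⟨r, hr, C, hball⟩ := exists_ball_forall_norm_le hU hf.continuousOn hz
  have hsmall : ∀ᶠ t : ℂ in 𝓝[≠] 0, ‖t • v‖ < r := by
    refine (Tendsto.eventually_lt_const (v := ‖(0 : ℂ) • v‖) (by simpa) ?_)
    exact ((continuous_id.smul continuous_const).norm.tendsto 0).mono_left nhdsWithin_le_nhds
  have hdiff : ∀ᶠ t : ℂ in 𝓝[≠] 0,
      DifferentiableOn ℂ (fun w => t⁻¹ • (f (w + t • v) - f w)) (ball z r) := by
    filter_upwards [hsmall] with t ht w hw
    have hat : ∀ w' ∈ ball w r, DifferentiableAt ℂ f w' := fun w' hw' =>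
      hf.differentiableAt (hU.mem_nhds ((hball w hw).1 hw'))
    have hshift : DifferentiableAt ℂ (fun w => f (w + t • v)) w :=
      (hat (w + t • v) (by simpa using ht)).comp w (differentiableAt_id.add_const _)
    exact ((hshift.sub (hat w (mem_ball_self hr))).const_smul t⁻¹).differentiableWithinAt
  have hlim : TendstoUniformlyOn (fun t w => t⁻¹ • (f (w + t • v) - f w))
      (fun w => fderiv ℂ f w v) (𝓝[≠] (0 : ℂ)) (ball z r) := by
    rw [Metric.tendstoUniformlyOn_iff]
    intro ε hε
    have hCt : ∀ᶠ t : ℂ in 𝓝[≠] 0, 4 * C * (‖v‖ / r) ^ 2 * ‖t‖ < ε := by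
      refine Tendsto.eventually_lt_const (v := 4 * C * (‖v‖ / r) ^ 2 * ‖(0 : ℂ)‖) (by simpa) ?_
      exact ((continuous_const.mul continuous_norm).tendsto 0).mono_left nhdsWithin_le_nhds
    filter_upwards [hsmall, hCt, self_mem_nhdsWithin] with t ht htε ht0 w hw
    rw [dist_comm, dist_eq_norm]
    exact (norm_slope_sub_fderiv_le (hf.mono (hball w hw).1) (hball w hw).2 ht0 ht).trans_lt htε
  exact (differentiableOn_of_tendstoUniformlyOn isOpen_ball hdiff hlim).differentiableAt
    (ball_mem_nhds z hr)

variable {G : Type*} [NormedAddCommGroup G] [NormedSpace ℂ G]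

theorem differentiableAt_of_forall_differentiableOn_apply {Φ : E → G →L[ℂ] F} (hr : 0 < r)
    (hC : ∀ w ∈ ball z r, ‖Φ w‖ ≤ C)
    (hΦ : ∀ v, DifferentiableOn ℂ (fun w => Φ w v) (ball z r)) : DifferentiableAt ℂ Φ z := by
  have hv : ∀ v, ∀ w ∈ ball z r, ‖Φ w v‖ ≤ C * ‖v‖ := fun v w hw =>
    (Φ w).le_of_opNorm_le (hC w hw) v
  have hat : ∀ v, DifferentiableAt ℂ (fun w => Φ w v) z := fun v =>
    (hΦ v).differentiableAt (ball_mem_nhds z hr)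
  let B : G →ₗ[ℂ] E →L[ℂ] F :=
    { toFun := fun v => fderiv ℂ (fun w => Φ w v) z
      map_add' := fun v v' => by simp_rw [map_add]; exact fderiv_fun_add (hat v) (hat v')
      map_smul' := fun c v => by simp_rw [map_smul]; exact fderiv_fun_const_smul (hat v) c }
  have hB : ∀ v, ‖B v‖ ≤ 2 * C / r * ‖v‖ := fun v =>
    (norm_fderiv_le_of_forall_mem_ball_norm_le (hΦ v) hr (hv v)).trans_eq (by ring)
  refine HasFDerivAt.differentiableAt (f' := (B.mkContinuous _ hB).flip) ?_
  have hO : (fun w => Φ w - Φ z - (B.mkContinuous _ hB).flip (w - z)) =O[𝓝 z]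
      fun w => ‖w - z‖ ^ 2 := by
    refine IsBigO.of_bound (4 * C / r ^ 2) ?_
    filter_upwards [ball_mem_nhds z hr] with w hw
    have hC0 : 0 ≤ C := (norm_nonneg _).trans (hC w hw)
    refine ContinuousLinearMap.opNorm_le_bound _ (by positivity) fun v => ?_
    rw [norm_pow, norm_norm]
    exact (norm_sub_sub_fderiv_le (hΦ v) (hv v) hw).trans_eq (by ring)
  exact .of_isLittleO (hO.trans_isLittleO (isLittleO_pow_sub_sub z one_lt_two))

theorem differentiableAt_fderiv [CompleteSpace F] (hU : IsOpen U) (hf : DifferentiableOn ℂ f U)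
    (hz : z ∈ U) : DifferentiableAt ℂ (fderiv ℂ f) z := by
  obtain ⟨r, hr, C, hball⟩ := exists_ball_forall_norm_le hU hf.continuousOn hz
  refine differentiableAt_of_forall_differentiableOn_apply hr (C := 2 * C / r) (fun w hw => ?_)
    fun v w hw => ?_
  · exact norm_fderiv_le_of_forall_mem_ball_norm_le (hf.mono (hball w hw).1) hr (hball w hw).2
  · exact (differentiableAt_fderiv_apply hU hf ((hball w hw).1 (mem_ball_self hr))
      v).differentiableWithinAt

end Holomorphy

theorem differentiableAt_of_comp_linearIsometry {E F G : Type*} [NormedAddCommGroup E]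
    [NormedSpace ℂ E] [NormedAddCommGroup F] [NormedSpace ℂ F] [CompleteSpace F]
    [NormedAddCommGroup G] [NormedSpace ℂ G] (T : F →ₗᵢ[ℂ] G) {f : E → F} {z : E}
    (h : DifferentiableAt ℂ (fun w => T (f w)) z) : DifferentiableAt ℂ f z := by
  obtain ⟨L, hL⟩ := h
  have hclosed : IsClosed (range T) := T.isometry.isClosedEmbedding.isClosed_range
  have hmem : ∀ v, L v ∈ LinearMap.range T.toLinearMap := fun v => by
    have hc : Filter.Tendsto (fun n : ℕ => ‖(n : ℂ)‖) Filter.atTop Filter.atTop := by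
      simpa only [Complex.norm_natCast] using tendsto_natCast_atTop_atTop (R := ℝ)
    refine hclosed.mem_of_tendsto (hL.lim v hc) (.of_forall fun n => ?_)
    exact ⟨(n : ℂ) • (f (z + (n : ℂ)⁻¹ • v) - f z), by simp⟩
  let L' : E →L[ℂ] F := (T.equivRange.symm.toContinuousLinearEquiv :
    LinearMap.range T.toLinearMap →L[ℂ] F) ∘L L.codRestrict _ hmem
  have hL' : ∀ v, T (L' v) = L v := fun v =>
    congrArg Subtype.val (T.equivRange.apply_symm_apply ⟨L v, hmem v⟩)
  refine ⟨L', ?_⟩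
  rw [hasFDerivAt_iff_isLittleO] at hL ⊢
  refine Asymptotics.IsLittleO.of_norm_left (hL.norm_left.congr_left fun w => ?_)
  rw [← hL', ← map_sub, ← map_sub, T.norm_map]

section ADifferentiableAt

variable (A : Type u) {E F G : Type*} [NormedAddCommGroup E] [NormedSpace ℂ E] [SMul A E]
  [NormedAddCommGroup F] [NormedSpace ℂ F] [SMul A F]
  [NormedAddCommGroup G] [NormedSpace ℂ G] [SMul A G]

/-- `f` is Fréchet differentiable at `z`, with an `A`-linear derivative; this is the condition that
`ADifferentiableOn` imposes at each point of an open set. -/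
def ADifferentiableAt (f : E → F) (z : E) : Prop :=
  DifferentiableAt ℂ f z ∧ ∀ (a : A) (h : E), fderiv ℂ f z (a • h) = a • fderiv ℂ f z h

variable {A}

namespace ADifferentiableAt

theorem of_hasFDerivAt {f : E → F} {z : E} {f' : E →L[ℂ] F} (hf : HasFDerivAt f f' z)
    (h : ∀ (a : A) (v : E), f' (a • v) = a • f' v) : ADifferentiableAt A f z :=
  ⟨hf.differentiableAt, fun a v => by rw [hf.fderiv, h]⟩

theorem continuousAt {f : E → F} {z : E} (hf : ADifferentiableAt A f z) : ContinuousAt f z :=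
  hf.1.continuousAt

theorem congr_of_eventuallyEq {f g : E → F} {z : E} (hf : ADifferentiableAt A f z)
    (h : g =ᶠ[𝓝 z] f) : ADifferentiableAt A g z :=
  ⟨hf.1.congr_of_eventuallyEq h, fun a v => by rw [h.fderiv_eq, hf.2]⟩

theorem comp {g : F → G} {f : E → F} (z : E) (hg : ADifferentiableAt A g (f z))
    (hf : ADifferentiableAt A f z) : ADifferentiableAt A (g ∘ f) z :=
  of_hasFDerivAt (hg.1.hasFDerivAt.comp z hf.1.hasFDerivAt) fun a v => by
    simp only [ContinuousLinearMap.comp_apply, hf.2, hg.2]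

theorem comp_of_eq {g : F → G} {f : E → F} {z : E} {y : F} (hg : ADifferentiableAt A g y)
    (hf : ADifferentiableAt A f z) (hy : f z = y) : ADifferentiableAt A (g ∘ f) z := by
  subst hy
  exact hg.comp z hf

theorem prodMk {f : E → F} {g : E → G} {z : E} (hf : ADifferentiableAt A f z)
    (hg : ADifferentiableAt A g z) : ADifferentiableAt A (fun w => (f w, g w)) z :=
  of_hasFDerivAt (hf.1.hasFDerivAt.prodMk hg.1.hasFDerivAt) fun a v =>
    Prod.ext (hf.2 a v) (hg.2 a v)

theorem fst (z : E × F) : ADifferentiableAt A (Prod.fst : E × F → E) z :=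
  of_hasFDerivAt hasFDerivAt_fst fun _ _ => rfl

theorem snd (z : E × F) : ADifferentiableAt A (Prod.snd : E × F → F) z :=
  of_hasFDerivAt hasFDerivAt_snd fun _ _ => rfl

theorem id (z : E) : ADifferentiableAt A (id : E → E) z :=
  of_hasFDerivAt (hasFDerivAt_id z) fun _ _ => rfl

end ADifferentiableAt

end ADifferentiableAt

namespace ADifferentiableAt

variable {A : Type u} [NormedCommRing A] {E F : Type*} [NormedAddCommGroup E] [NormedSpace ℂ E]
  [Module A E] [NormedAddCommGroup F] [NormedSpace ℂ F] [Module A F] {f g : E → F} {z : E}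

theorem const (c : F) (z : E) : ADifferentiableAt A (fun _ : E => c) z :=
  of_hasFDerivAt (hasFDerivAt_const c z) fun _ _ => by simp

theorem add (hf : ADifferentiableAt A f z) (hg : ADifferentiableAt A g z) :
    ADifferentiableAt A (fun w => f w + g w) z :=
  of_hasFDerivAt (hf.1.hasFDerivAt.add hg.1.hasFDerivAt) fun a v => by
    simp [hf.2, hg.2]

variable [NormedAlgebra ℂ A]

theorem smul [IsScalarTower ℂ A F] [IsBoundedSMul A F] {c : E → A} (hc : ADifferentiableAt A c z)
    (hf : ADifferentiableAt A f z) : ADifferentiableAt A (fun w => c w • f w) z :=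
  of_hasFDerivAt (hc.1.hasFDerivAt.smul hf.1.hasFDerivAt) fun a v => by
    simp [hc.2, hf.2, smul_smul, mul_comm]

theorem fderiv_apply [CompleteSpace F] [ContinuousConstSMul A F] [IsScalarTower ℂ A F] {U : Set E}
    (hU : IsOpen U) (hf : ∀ w ∈ U, ADifferentiableAt A f w) (hz : z ∈ U) (v : E) :
    ADifferentiableAt A (fun w => fderiv ℂ f w v) z := by
  have hd : DifferentiableAt ℂ (fderiv ℂ f) z :=
    differentiableAt_fderiv hU (fun w hw => (hf w hw).1.differentiableWithinAt) hz
  have hderiv : ∀ y, HasFDerivAt (fun w => fderiv ℂ f w y)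
      ((ContinuousLinearMap.apply ℂ F y).comp (fderiv ℂ (fderiv ℂ f) z)) z := fun y =>
    (ContinuousLinearMap.apply ℂ F y).hasFDerivAt.comp z hd.hasFDerivAt
  have hsymm : ∀ x y, fderiv ℂ (fderiv ℂ f) z x y = fderiv ℂ (fderiv ℂ f) z y x :=
    second_derivative_symmetric_of_eventually
      ((hU.eventually_mem hz).mono fun w hw => (hf w hw).1.hasFDerivAt) hd.hasFDerivAt
  have : SMulCommClass ℂ A F := IsScalarTower.to_smulCommClass
  have hlin : ∀ (a : A) (x y : E),
      fderiv ℂ (fderiv ℂ f) z x (a • y) = a • fderiv ℂ (fderiv ℂ f) z x y := fun a x y => by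
    have heq : (fun w => fderiv ℂ f w (a • y)) =ᶠ[𝓝 z] fun w => a • fderiv ℂ f w y :=
      (hU.eventually_mem hz).mono fun w hw => (hf w hw).2 a y
    exact DFunLike.congr_fun
      (((hderiv (a • y)).congr_of_eventuallyEq heq.symm).unique ((hderiv y).const_smul a)) x
  refine of_hasFDerivAt (hderiv v) fun a x => ?_
  -- The second derivative is `A`-linear in its second argument, hence by symmetry in its first.
  change fderiv ℂ (fderiv ℂ f) z (a • x) v = a • fderiv ℂ (fderiv ℂ f) z x v
  rw [hsymm, hlin, hsymm]

end ADifferentiableAt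

namespace AltForm

section Pullback

variable {A : Type u} [NormedCommRing A] {X : Type w} [AddCommGroup X] [Module A X]
  [TopologicalSpace X] {Y : Type w₁} [AddCommGroup Y] [Module A Y] [TopologicalSpace Y]

/-- The pull back of forms along a continuous `A`-linear map, as an `A`-linear map. -/
def pullbackₗ (F : X →L[A] Y) (k : ℕ) : AltForm A Y k →ₗ[A] AltForm A X k where
  toFun := pullback F
  map_add' _ _ := rfl
  map_smul' _ _ := rfl

end Pullback

variable {A : Type u} [NormedCommRing A] [NormedAlgebra ℂ A] {X : BanachMod.{u, w} A}
  {Y : BanachMod.{u, w₁} A} {k : ℕ}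

/-- `toComplex` as a linear isometry, to reduce differentiability in `A_A^k(X)` to
differentiability in the space of continuous `ℂ`-multilinear maps. -/
noncomputable def toComplexₗᵢ (X : BanachMod.{u, w} A) (k : ℕ) :
    AltForm A X k →ₗᵢ[ℂ] ContinuousMultilinearMap ℂ (fun _ : Fin k => (X : Type w)) A where
  toFun := toComplex X k
  map_add' := (toComplex X k).map_add
  map_smul' c f := by
    ext x
    exact (Algebra.smul_def c (f x)).symm
  norm_map' _ := rfl

theorem toComplexₗᵢ_eventuallyEq {E : Type*} [TopologicalSpace E] {ω : E → AltForm A Y k}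
    {D : E → X →L[ℂ] Y} {F : E → AltForm A X k} {z : E}
    (hF : ∀ᶠ w in 𝓝 z, ∀ x : Fin k → X, F w x = ω w (fun i => D w (x i))) :
    (fun w => toComplexₗᵢ X k (F w)) =ᶠ[𝓝 z]
      fun w => (toComplexₗᵢ Y k (ω w)).compContinuousLinearMap fun _ => D w :=
  hF.mono fun _ hw => ContinuousMultilinearMap.ext hw

variable {E : Type*} [NormedAddCommGroup E] [NormedSpace ℂ E] {ω : E → AltForm A Y k}
  {D : E → X →L[ℂ] Y} {F : E → AltForm A X k} {z : E}

theorem differentiableAt_of_eventually_eq_comp [CompleteSpace A] (hω : DifferentiableAt ℂ ω z)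
    (hD : DifferentiableAt ℂ D z)
    (hF : ∀ᶠ w in 𝓝 z, ∀ x : Fin k → X, F w x = ω w (fun i => D w (x i))) :
    DifferentiableAt ℂ F z := by
  have hω' : DifferentiableAt ℂ (fun w => toComplexₗᵢ Y k (ω w)) z :=
    (toComplexₗᵢ Y k).toContinuousLinearMap.differentiableAt.comp z hω
  exact differentiableAt_of_comp_linearIsometry (toComplexₗᵢ X k)
    ((hω'.continuousMultilinearMapCompContinuousLinearMap fun _ => hD).congr_of_eventuallyEq
      (toComplexₗᵢ_eventuallyEq hF))

theorem fderiv_apply_of_eventually_eq_comp [CompleteSpace A] (hω : DifferentiableAt ℂ ω z)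
    (hD : DifferentiableAt ℂ D z)
    (hF : ∀ᶠ w in 𝓝 z, ∀ x : Fin k → X, F w x = ω w (fun i => D w (x i))) (v : E)
    (x : Fin k → X) :
    fderiv ℂ F z v x = fderiv ℂ ω z v (fun i => D z (x i)) +
      ∑ i, ω z (Function.update (fun j => D z (x j)) i (fderiv ℂ D z v (x i))) := by
  have hω' : HasFDerivAt (fun w => toComplexₗᵢ Y k (ω w))
      ((toComplexₗᵢ Y k).toContinuousLinearMap ∘L fderiv ℂ ω z) z :=
    (toComplexₗᵢ Y k).toContinuousLinearMap.hasFDerivAt.comp z hω.hasFDerivAt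
  have hF' : HasFDerivAt (fun w => toComplexₗᵢ X k (F w))
      ((toComplexₗᵢ X k).toContinuousLinearMap ∘L fderiv ℂ F z) z :=
    (toComplexₗᵢ X k).toContinuousLinearMap.hasFDerivAt.comp z
      (differentiableAt_of_eventually_eq_comp hω hD hF).hasFDerivAt
  have heq := hF'.unique ((hω'.continuousMultilinearMapCompContinuousLinearMap
    fun _ => hD.hasFDerivAt).congr_of_eventuallyEq (toComplexₗᵢ_eventuallyEq hF))
  refine (DFunLike.congr_fun (DFunLike.congr_fun heq v) x).trans ?_
  simp only [add_apply, ContinuousLinearMap.comp_apply,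
    ContinuousMultilinearMap.fderivCompContinuousLinearMap_apply]
  refine congrArg₂ (· + ·) rfl (Finset.sum_congr rfl fun i _ => congrArg (ω z) (funext fun j => ?_))
  rcases eq_or_ne j i with rfl | hj
  · simp
  · simp [hj]

theorem aDifferentiableAt_of_eventually_eq_comp [CompleteSpace A] [SMul A E]
    (hω : ADifferentiableAt A ω z) (hD : DifferentiableAt ℂ D z)
    (hDx : ∀ x, ADifferentiableAt A (fun w => D w x) z)
    (hF : ∀ᶠ w in 𝓝 z, ∀ x : Fin k → X, F w x = ω w (fun i => D w (x i))) :
    ADifferentiableAt A F z := by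
  have hDsmul : ∀ (a : A) (v : E) (x : X), fderiv ℂ D z (a • v) x = a • fderiv ℂ D z v x :=
    fun a v x => by
      have hx : fderiv ℂ (fun w => D w x) z = (fderiv ℂ D z).flip x := by
        simpa using fderiv_clm_apply hD (differentiableAt_const x)
      simpa only [hx, ContinuousLinearMap.flip_apply] using (hDx x).2 a v
  refine ⟨differentiableAt_of_eventually_eq_comp hω.1 hD hF, fun a v => toComplex_injective X k ?_⟩
  ext x
  change fderiv ℂ F z (a • v) x = a * fderiv ℂ F z v x
  rw [fderiv_apply_of_eventually_eq_comp hω.1 hD hF, fderiv_apply_of_eventually_eq_comp hω.1 hD hF,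
    hω.2, mul_add, Finset.mul_sum]
  refine congrArg₂ (· + ·) rfl (Finset.sum_congr rfl fun i _ => ?_)
  rw [hDsmul]
  exact (ω z).toMultilinear.map_update_smul _ i a _

end AltForm

section Manifolds

variable {A : Type u} [NormedCommRing A] [NormedAlgebra ℂ A]

namespace AChart.IsOpenHomeo

variable {M : Type v} [TopologicalSpace M] {φ : AChart.{u, v, w} A M} {p : M}

theorem eventually_mem_source (hφ : φ.IsOpenHomeo) (hp : p ∈ φ.source) :
    ∀ᶠ q in 𝓝 p, q ∈ φ.source :=
  hφ.isOpen_source.eventually_mem hp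

theorem continuousAt (hφ : φ.IsOpenHomeo) (hp : p ∈ φ.source) : ContinuousAt φ p :=
  hφ.continuousOn.continuousAt (hφ.eventually_mem_source hp)

theorem eventually_mem_target (hφ : φ.IsOpenHomeo) (hp : p ∈ φ.source) :
    ∀ᶠ z in 𝓝 (φ p), z ∈ φ.target :=
  hφ.isOpen_target.eventually_mem (φ.toPartialEquiv.map_source hp)

theorem eventually_left_inv (hφ : φ.IsOpenHomeo) (hp : p ∈ φ.source) :
    ∀ᶠ q in 𝓝 p, φ.symm (φ q) = q :=
  (hφ.eventually_mem_source hp).mono fun _ hq => φ.toPartialEquiv.left_inv hq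

theorem eventually_right_inv (hφ : φ.IsOpenHomeo) (hp : p ∈ φ.source) :
    ∀ᶠ z in 𝓝 (φ p), φ (φ.symm z) = z :=
  (hφ.eventually_mem_target hp).mono fun _ hz => φ.toPartialEquiv.right_inv hz

theorem tendsto_symm (hφ : φ.IsOpenHomeo) (hp : p ∈ φ.source) :
    Filter.Tendsto φ.symm (𝓝 (φ p)) (𝓝 p) := by
  simpa only [ContinuousAt, φ.toPartialEquiv.left_inv hp] using
    hφ.continuousOn_symm.continuousAt (hφ.eventually_mem_target hp)

theorem prod {N : Type v₂} [TopologicalSpace N] {ψ : AChart.{u, v₂, w₂} A N} (hφ : φ.IsOpenHomeo)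
    (hψ : ψ.IsOpenHomeo) : (φ.prod ψ).IsOpenHomeo where
  isOpen_source := hφ.isOpen_source.prod hψ.isOpen_source
  isOpen_target := hφ.isOpen_target.prod hψ.isOpen_target
  continuousOn := hφ.continuousOn.prodMap hψ.continuousOn
  continuousOn_symm := hφ.continuousOn_symm.prodMap hψ.continuousOn_symm

theorem idChart (X : BanachMod.{u, w} A) : X.idChart.IsOpenHomeo where
  isOpen_source := isOpen_univ
  isOpen_target := isOpen_univ
  continuousOn := continuousOn_id
  continuousOn_symm := continuousOn_id

end AChart.IsOpenHomeo

namespace IsAManifold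

variable {M : Type v} [TopologicalSpace M] {ι : Type v₁} {S : ι → AChart.{u, v, w} A M}

theorem aDifferentiableAt_trans (hS : IsAManifold S) {i j : ι} {p : M} (hi : p ∈ (S i).source)
    (hj : p ∈ (S j).source) : ADifferentiableAt A (S j ∘ (S i).symm) (S i p) :=
  hS.compat i j _ ⟨p, ⟨hi, hj⟩, rfl⟩

theorem isOpen_image_inter (hS : IsAManifold S) (i j : ι) :
    IsOpen (S i '' ((S i).source ∩ (S j).source)) := by
  rw [(S i).toPartialEquiv.image_source_inter_eq']
  exact (hS.homeo i).continuousOn_symm.isOpen_inter_preimage (hS.homeo i).isOpen_target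
    (hS.homeo j).isOpen_source

theorem idChart (X : BanachMod.{u, w} A) : IsAManifold fun _ : Unit => X.idChart where
  t2 := inferInstance
  homeo _ := .idChart X
  cover p := ⟨(), mem_univ p⟩
  compat _ _ z _ := ADifferentiableAt.id z

theorem idChart_prod (hS : IsAManifold S) (X : BanachMod.{u, w₁} A) :
    IsAManifold fun i => X.idChart.prod (S i) where
  t2 := have := hS.t2; inferInstance
  homeo i := (AChart.IsOpenHomeo.idChart X).prod (hS.homeo i)
  cover p := (hS.cover p.2).imp fun _ hi => ⟨mem_univ _, hi⟩
  compat i j := by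
    rintro _ ⟨⟨x, p⟩, ⟨hi, hj⟩, rfl⟩
    exact (ADifferentiableAt.fst _).prodMk
      (ADifferentiableAt.comp (f := Prod.snd) (x, S i p) (hS.aDifferentiableAt_trans hi.2 hj.2)
        (.snd _))

end IsAManifold

variable {M : Type v₁} [TopologicalSpace M] {ι : Type*} {S : ι → AChart.{u, v₁, w₁} A M}
  {N : Type v₂} [TopologicalSpace N] {κ : Type*} {T : κ → AChart.{u, v₂, w₂} A N}
  {F G : M → N} {p : M}

/-- `F` is continuous at `p`, and `A`-differentiable at `p` in all coordinates; this is the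
condition that `AHolomorphic` imposes at each point of an open set. -/
def AHolomorphicAt (S : ι → AChart.{u, v₁, w₁} A M) (T : κ → AChart.{u, v₂, w₂} A N) (F : M → N)
    (p : M) : Prop :=
  ContinuousAt F p ∧ ∀ i j, p ∈ (S i).source → F p ∈ (T j).source →
    ADifferentiableAt A (T j ∘ F ∘ (S i).symm) (S i p)

theorem aHolomorphic_iff_forall_aHolomorphicAt (hS : ∀ i, (S i).IsOpenHomeo)
    (hT : ∀ j, IsOpen (T j).source) {U : Set M} (hU : IsOpen U) {f : U → N}
    (hF : ∀ p : U, F p = f p) : AHolomorphic S T f ↔ ∀ p ∈ U, AHolomorphicAt S T F p := by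
  obtain rfl : U.domRestrict F = f := funext hF
  refine ⟨fun h p hp => ?_, fun h => ⟨?_, fun i j => ⟨T j ∘ F ∘ (S i).symm, ?_, ?_⟩⟩⟩
  · have hc : ContinuousAt F p :=
      (continuousOn_iff_continuous_domRestrict.2 h.1).continuousAt (hU.mem_nhds hp)
    refine ⟨hc, fun i j hi hj => ?_⟩
    obtain ⟨g, hg, hgd⟩ := h.2 i j
    refine ADifferentiableAt.congr_of_eventuallyEq (hgd _ ⟨⟨p, hp⟩, hi, hj, rfl⟩) ?_
    have hsymm := (hS i).tendsto_symm hi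
    filter_upwards [(hS i).eventually_mem_target hi, (hS i).eventually_right_inv hi,
      hsymm.eventually (hU.eventually_mem hp),
      hsymm.eventually (hc.eventually ((hT j).eventually_mem hj))] with z hz hinv hzU hzj
    have := hg ⟨(S i).symm z, hzU⟩ ((S i).toPartialEquiv.map_target hz) hzj
    rw [hinv] at this
    exact this.symm
  · exact continuousOn_iff_continuous_domRestrict.1 fun p hp => (h p hp).1.continuousWithinAt
  · intro q hq _
    exact congrArg (T j ∘ F) ((S i).toPartialEquiv.left_inv hq)
  · rintro _ ⟨q, hq, hfq, rfl⟩
    exact (h q q.2).2 i j hq hfq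

theorem AHolomorphicAt.congr_of_eventuallyEq (hS : ∀ i, (S i).IsOpenHomeo)
    (hF : AHolomorphicAt S T F p) (h : G =ᶠ[𝓝 p] F) : AHolomorphicAt S T G p :=
  ⟨hF.1.congr h.symm, fun i j hi hj =>
    (hF.2 i j hi (h.self_of_nhds ▸ hj)).congr_of_eventuallyEq
      ((((hS i).tendsto_symm hi).eventually h).mono fun _ hz => congrArg (T j) hz)⟩

theorem AHolomorphicAt.of_chart (hS : IsAManifold S) (hT : IsAManifold T) {i : ι} {j : κ}
    (hi : p ∈ (S i).source) (hF : ∀ᶠ q in 𝓝 p, F q ∈ (T j).source)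
    (h : ADifferentiableAt A (T j ∘ F ∘ (S i).symm) (S i p)) : AHolomorphicAt S T F p := by
  have hj : F p ∈ (T j).source := hF.self_of_nhds
  have hp : (S i).symm (S i p) = p := (S i).toPartialEquiv.left_inv hi
  have hFj : ∀ᶠ q in 𝓝 p, (T j).symm (T j (F q)) = F q :=
    hF.mono fun q hq => (T j).toPartialEquiv.left_inv hq
  have hval : (T j ∘ F ∘ (S i).symm) (S i p) = T j (F p) := congrArg (T j ∘ F) hp
  refine ⟨?_, fun i' j' hi' hj' => ?_⟩
  · have hc := (h.continuousAt.comp ((hS.homeo i).continuousAt hi)).tendsto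
    rw [Function.comp_apply, hval] at hc
    refine (((hT.homeo j).tendsto_symm hj).comp hc).congr' ?_
    filter_upwards [(hS.homeo i).eventually_left_inv hi, hFj] with q hq hq'
    simp only [Function.comp_apply, hq, hq']
  · have hd := h.comp_of_eq (hS.aDifferentiableAt_trans hi' hi)
      (congrArg (S i) ((S i').toPartialEquiv.left_inv hi'))
    have hval' : ((T j ∘ F ∘ (S i).symm) ∘ S i ∘ (S i').symm) (S i' p) = T j (F p) := by
      simp only [Function.comp_apply, (S i').toPartialEquiv.left_inv hi', hp]
    refine ((hT.aDifferentiableAt_trans hj hj').comp_of_eq hd hval').congr_of_eventuallyEq ?_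
    have hsymm := (hS.homeo i').tendsto_symm hi'
    filter_upwards [hsymm.eventually ((hS.homeo i).eventually_left_inv hi),
      hsymm.eventually hFj] with z hz hz'
    simp only [Function.comp_apply, hz, hz']

theorem aHolomorphicAt_iff_chart (hS : IsAManifold S) (hT : IsAManifold T) {i : ι} {j : κ}
    (hi : p ∈ (S i).source) (hF : ∀ᶠ q in 𝓝 p, F q ∈ (T j).source) :
    AHolomorphicAt S T F p ↔ ADifferentiableAt A (T j ∘ F ∘ (S i).symm) (S i p) :=
  ⟨fun h => h.2 i j hi hF.self_of_nhds, .of_chart hS hT hi hF⟩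

end Manifolds

namespace CotangentBundle

variable {A : Type u} [NormedCommRing A] [NormedAlgebra ℂ A] {M : Type v} [TopologicalSpace M]
  {ι : Type v₁} {S : ι → AChart.{u, v, w} A M} {hS : IsAManifold S} {k : ℕ} {i j : ι}

section FiberCoord

variable {p : M} {ω : CotangentBundle hS k}

theorem fiberCoord_apply (hi : ω.proj ∈ (S i).source) (x : Fin k → (S i).Model) :
    fiberCoord hS k i ω x = ω.form (fun l => (TangentSp.coordL hS hi).symm (x l)) := by
  simp only [fiberCoord, dif_pos hi]
  rfl

theorem fiberCoord_apply_transD (hi : ω.proj ∈ (S i).source) (hj : ω.proj ∈ (S j).source)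
    (x : Fin k → (S j).Model) :
    fiberCoord hS k j ω x = fiberCoord hS k i ω (fun l => transD S ω.proj j i (x l)) := by
  rw [fiberCoord_apply hi, fiberCoord_apply hj]
  refine congrArg ω.form (funext fun l => ?_)
  exact ((TangentSp.coord hS hi).symm_apply_apply ((TangentSp.coord hS hj).symm (x l))).symm

theorem fiberCoord_injective (hi : p ∈ (S i).source) :
    Function.Injective fun f : CotangentSp hS k p => fiberCoord hS k i ⟨p, f⟩ := fun f g h => by
  have heq : (⟨p, f⟩ : CotangentBundle hS k) = ⟨p, g⟩ :=
    (ofFiberCoord_fiberCoord hS k i ⟨p, f⟩ hi).symm.trans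
      ((congrArg (ofFiberCoord hS k i p) h).trans (ofFiberCoord_fiberCoord hS k i ⟨p, g⟩ hi))
  cases heq
  rfl

variable (hS k i p) in
open Classical in
/-- `fiberCoord` on the forms at the single point `p`, as an `A`-linear map. -/
noncomputable def fiberCoordₗ : CotangentSp hS k p →ₗ[A] AltForm A (S i).Model k :=
  if hi : p ∈ (S i).source then
    AltForm.pullbackₗ ((TangentSp.coordL hS hi).symm : (S i).Model →L[A] TangentSp hS p) k
  else 0

theorem fiberCoordₗ_apply (f : CotangentSp hS k p) :
    fiberCoordₗ hS k i p f = fiberCoord hS k i ⟨p, f⟩ := by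
  unfold fiberCoordₗ fiberCoord
  split_ifs <;> rfl

variable [CompleteSpace A]

theorem aDifferentiableAt_fiberCoord {E : Type*} [NormedAddCommGroup E] [NormedSpace ℂ E] [SMul A E]
    {ω : E → CotangentBundle hS k} {z : E}
    (hω : ADifferentiableAt A (fun w => fiberCoord hS k i (ω w)) z)
    (hp : ADifferentiableAt A (fun w => S i (ω w).proj) z)
    (hi : ∀ᶠ w in 𝓝 z, (ω w).proj ∈ (S i).source)
    (hj : ∀ᶠ w in 𝓝 z, (ω w).proj ∈ (S j).source) :
    ADifferentiableAt A (fun w => fiberCoord hS k j (ω w)) z := by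
  have hiz := hi.self_of_nhds
  have hjz := hj.self_of_nhds
  have hpj : ADifferentiableAt A (fun w => S j (ω w).proj) z := by
    refine ((hS.aDifferentiableAt_trans hiz hjz).comp z hp).congr_of_eventuallyEq ?_
    exact hi.mono fun w hw => congrArg (S j) ((S i).toPartialEquiv.left_inv hw).symm
  have hopen := hS.isOpen_image_inter j i
  have hmem : S j (ω z).proj ∈ S j '' ((S j).source ∩ (S i).source) := ⟨_, ⟨hjz, hiz⟩, rfl⟩
  have hD : DifferentiableAt ℂ (fderiv ℂ (S i ∘ (S j).symm)) (S j (ω z).proj) :=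
    differentiableAt_fderiv hopen
      (fun y hy => (hS.compat j i y hy).1.differentiableWithinAt) hmem
  refine AltForm.aDifferentiableAt_of_eventually_eq_comp (D := fun w => transD S (ω w).proj j i)
    hω (hD.comp z hpj.1) (fun x => ?_) ?_
  · exact (ADifferentiableAt.fderiv_apply hopen (hS.compat j i) hmem x).comp z hpj
  · filter_upwards [hi, hj] with w hw hw' x using fiberCoord_apply_transD hw hw' x

theorem aDifferentiableAt_fiberCoord_chart_symm (hi : ω.proj ∈ (S i).source)
    (hj : ω.proj ∈ (S j).source) :
    ADifferentiableAt A (fun z => fiberCoord hS k j ((chart hS k i).symm z)) (chart hS k i ω) := by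
  have hsnd : Filter.Tendsto Prod.snd (𝓝 (chart hS k i ω)) (𝓝 (S i ω.proj)) :=
    continuous_snd.tendsto _
  have htarget : ∀ᶠ z in 𝓝 (chart hS k i ω), z ∈ (chart hS k i).target :=
    hsnd.eventually ((hS.homeo i).eventually_mem_target hi)
  have hinv : ∀ᶠ z in 𝓝 (chart hS k i ω), chart hS k i ((chart hS k i).symm z) = z :=
    htarget.mono fun z hz => (chart hS k i).toPartialEquiv.right_inv hz
  refine aDifferentiableAt_fiberCoord (i := i) ?_ ?_ ?_ ?_
  · exact (ADifferentiableAt.fst _).congr_of_eventuallyEq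
      (hinv.mono fun _ hz => congrArg Prod.fst hz)
  · exact (ADifferentiableAt.snd _).congr_of_eventuallyEq
      (hinv.mono fun _ hz => congrArg Prod.snd hz)
  · exact htarget.mono fun z hz => (chart hS k i).toPartialEquiv.map_target hz
  · exact ((hS.homeo i).tendsto_symm hi |>.comp hsnd).eventually
      ((hS.homeo j).eventually_mem_source hj)

end FiberCoord

section Topology

theorem isOpen_openBase {G : Set (AltForm A (S i).Model k)} {V : Set M} (hG : IsOpen G)
    (hV : IsOpen V) (hVi : V ⊆ (S i).source) :
    IsOpen {ω : CotangentBundle hS k | fiberCoord hS k i ω ∈ G ∧ ω.proj ∈ V} :=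
  isOpen_generateFrom_of_mem ⟨i, G, V, hG, hV, hVi, rfl⟩

theorem continuous_proj : Continuous (proj : CotangentBundle hS k → M) := by
  refine continuous_def.2 fun V hV => isOpen_iff_forall_mem_open.2 fun ω hω => ?_
  obtain ⟨i, hi⟩ := hS.cover ω.proj
  exact ⟨_, fun η hη => hη.2.1, isOpen_openBase (i := i) isOpen_univ
    (hV.inter (hS.homeo i).isOpen_source) inter_subset_right, mem_univ _, hω, hi⟩

theorem continuousOn_fiberCoord :
    ContinuousOn (fiberCoord hS k i) {ω | ω.proj ∈ (S i).source} := by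
  refine (continuousOn_open_iff ((hS.homeo i).isOpen_source.preimage continuous_proj)).2
    fun G hG => ?_
  have := isOpen_openBase (hS := hS) hG (hS.homeo i).isOpen_source Subset.rfl
  rwa [ofPred_and, inter_comm] at this

variable (hS k)

theorem t2Space : T2Space (CotangentBundle hS k) := by
  have := hS.t2
  refine ⟨fun ω η hne => ?_⟩
  rcases ne_or_eq ω.proj η.proj with hproj | hproj
  · exact separated_by_continuous continuous_proj hproj
  obtain ⟨p, f⟩ := ω
  obtain ⟨q, g⟩ := η
  obtain rfl : p = q := hproj
  obtain ⟨i, hi⟩ := hS.cover p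
  have hfg : fiberCoord hS k i ⟨p, f⟩ ≠ fiberCoord hS k i ⟨p, g⟩ := fun h =>
    hne (congrArg _ (fiberCoord_injective hi h))
  obtain ⟨G, H, hG, hH, hf, hg, hGH⟩ := t2_separation hfg
  refine ⟨_, _, isOpen_openBase hG (hS.homeo i).isOpen_source Subset.rfl,
    isOpen_openBase hH (hS.homeo i).isOpen_source Subset.rfl, ⟨hf, hi⟩, ⟨hg, hi⟩, ?_⟩
  exact disjoint_left.2 fun ω h₁ h₂ => disjoint_left.1 hGH h₁.1 h₂.1

variable [CompleteSpace A]

variable {hS k} in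
theorem tendsto_chart_symm {ω : CotangentBundle hS k} (hi : ω.proj ∈ (S i).source) :
    Filter.Tendsto (chart hS k i).symm (𝓝 (chart hS k i ω)) (𝓝 ω) := by
  have hω : (chart hS k i).symm (chart hS k i ω) = ω := (chart hS k i).toPartialEquiv.left_inv hi
  refine tendsto_nhds_generateFrom_iff.2 ?_
  rintro _ ⟨j, G, V, hG, hV, hVj, rfl⟩ ⟨hωG, hωV⟩
  have hfiber := (aDifferentiableAt_fiberCoord_chart_symm hi (hVj hωV)).continuousAt.eventually
    (hG.eventually_mem (by simpa only [hω] using hωG))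
  have hbase := (((hS.homeo i).tendsto_symm hi).comp (continuous_snd.tendsto
    (chart hS k i ω))).eventually (hV.eventually_mem hωV)
  filter_upwards [hfiber, hbase] with z hz hz' using ⟨hz, hz'⟩

theorem isTopologicalBasis_openBase : IsTopologicalBasis (openBase hS k) := by
  refine isTopologicalBasis_of_isOpen_of_nhds (fun W hW => isOpen_generateFrom_of_mem hW)
    fun ω W hω hW => ?_
  obtain ⟨i, hi⟩ := hS.cover ω.proj
  obtain ⟨G, Q, hG, hωG, hQ, hωQ, hGQ⟩ :=
    mem_nhds_prod_iff'.1 (tendsto_chart_symm hi (hW.mem_nhds hω))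
  refine ⟨_, ⟨i, G, (S i).source ∩ S i ⁻¹' Q, hG, (hS.homeo i).continuousOn.isOpen_inter_preimage
    (hS.homeo i).isOpen_source hQ, inter_subset_left, rfl⟩, ⟨hωG, hi, hωQ⟩, ?_⟩
  rintro η ⟨hηG, hη, hηQ⟩
  have hη' : (chart hS k i).symm (chart hS k i η) = η := (chart hS k i).toPartialEquiv.left_inv hη
  exact hη' ▸ hGQ ⟨hηG, hηQ⟩

theorem isOpenHomeo_chart (i : ι) : (chart hS k i).IsOpenHomeo where
  isOpen_source := (hS.homeo i).isOpen_source.preimage continuous_proj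
  isOpen_target := (hS.homeo i).isOpen_target.preimage continuous_snd
  continuousOn := continuousOn_fiberCoord.prodMk
    ((hS.homeo i).continuousOn.comp continuous_proj.continuousOn fun _ h => h)
  continuousOn_symm z hz := by
    have hc := tendsto_chart_symm ((chart hS k i).toPartialEquiv.map_target hz)
    rw [(chart hS k i).toPartialEquiv.right_inv hz] at hc
    exact ContinuousAt.continuousWithinAt hc

theorem isAManifold_chart : IsAManifold (chart hS k) where
  t2 := t2Space hS k
  homeo := isOpenHomeo_chart hS k
  cover ω := hS.cover ω.proj
  compat i j := by
    rintro _ ⟨ω, ⟨hi, hj⟩, rfl⟩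
    exact (aDifferentiableAt_fiberCoord_chart_symm hi hj).prodMk
      ((hS.aDifferentiableAt_trans hi hj).comp (f := Prod.snd) (chart hS k i ω) (.snd _))

end Topology

section VectorBundle

variable (hS k)

/-- The local trivialization induced by a chart, as a bijection from the preimage of its domain. -/
noncomputable def trivEquiv (i : ι) : (proj ⁻¹' (S i).source : Set (CotangentBundle hS k)) ≃
    (univ ×ˢ (S i).source : Set (AltForm A (S i).Model k × M)) where
  toFun ω := ⟨(fiberCoord hS k i ω, ω.1.proj), mem_univ _, ω.2⟩
  invFun z := ⟨ofFiberCoord hS k i z.1.2 z.1.1, z.2.2⟩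
  left_inv ω := Subtype.ext (ofFiberCoord_fiberCoord hS k i ω.1 ω.2)
  right_inv z := Subtype.ext (Prod.ext (fiberCoord_ofFiberCoord hS k i _ z.2.2 _) rfl)

variable [CompleteSpace A]

theorem aHolomorphicAt_proj (ω : CotangentBundle hS k) : AHolomorphicAt (chart hS k) S proj ω := by
  obtain ⟨i, hi⟩ := hS.cover ω.proj
  refine .of_chart (isAManifold_chart hS k) hS (i := i) (j := i) hi
    ((isOpenHomeo_chart hS k i).eventually_mem_source hi) ?_
  exact (ADifferentiableAt.snd _).congr_of_eventuallyEq
    (((isOpenHomeo_chart hS k i).eventually_right_inv hi).mono fun _ hz => congrArg Prod.snd hz)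

variable {hS k}

theorem aHolomorphicAt_trivialization {ω : CotangentBundle hS k} (hi : ω.proj ∈ (S i).source) :
    AHolomorphicAt (chart hS k) (fun l => (AltForm.banach (S i).Model k).idChart.prod (S l))
      (fun η => (fiberCoord hS k i η, η.proj)) ω := by
  have hsource := (isOpenHomeo_chart hS k i).eventually_mem_source hi
  refine .of_chart (isAManifold_chart hS k) (hS.idChart_prod _) (i := i) (j := i) hi
    (hsource.mono fun _ hη => ⟨mem_univ _, hη⟩) ?_
  exact (ADifferentiableAt.id _).congr_of_eventuallyEq
    ((isOpenHomeo_chart hS k i).eventually_right_inv hi)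

theorem aHolomorphicAt_trivialization_symm {z : AltForm A (S i).Model k × M}
    (hi : z.2 ∈ (S i).source) :
    AHolomorphicAt (fun l => (AltForm.banach (S i).Model k).idChart.prod (S l)) (chart hS k)
      (fun z => ofFiberCoord hS k i z.2 z.1) z := by
  have hz : z ∈ ((AltForm.banach (S i).Model k).idChart.prod (S i)).source := ⟨mem_univ _, hi⟩
  have hprod := (hS.idChart_prod (AltForm.banach (S i).Model k)).homeo i
  refine .of_chart (hS.idChart_prod _) (isAManifold_chart hS k) (i := i) (j := i) hz
    ((hprod.eventually_mem_source hz).mono fun _ hw => hw.2) ?_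
  exact (ADifferentiableAt.id _).congr_of_eventuallyEq
    ((hprod.eventually_mem_target hz).mono fun _ hw => (chart hS k i).toPartialEquiv.right_inv hw.2)

variable (hS k)

theorem isAHolomorphicVectorBundle :
    IsAHolomorphicVectorBundle (chart hS k) S proj (localTriv hS k) where
  total := isAManifold_chart hS k
  base := hS
  proj_holomorphic := (aHolomorphic_iff_forall_aHolomorphicAt (isOpenHomeo_chart hS k)
    (fun j => (hS.homeo j).isOpen_source) isOpen_univ fun _ => rfl).2
      fun ω _ => aHolomorphicAt_proj hS k ω
  proj_surjective p := ⟨⟨p, 0⟩, rfl⟩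
  isOpen_base i := (hS.homeo i).isOpen_source
  cover := eq_univ_of_forall fun p => mem_iUnion.2 (hS.cover p)
  biholomorphic i := by
    have hprod := (hS.idChart_prod (AltForm.banach (S i).Model k)).homeo
    have hchart := isOpenHomeo_chart hS k
    refine ⟨trivEquiv hS k i, fun _ => rfl, ?_, ?_⟩
    · exact (aHolomorphic_iff_forall_aHolomorphicAt hchart (fun l => (hprod l).isOpen_source)
        (hchart i).isOpen_source fun _ => rfl).2 fun ω hω => aHolomorphicAt_trivialization hω
    · exact (aHolomorphic_iff_forall_aHolomorphicAt hprod (fun l => (hchart l).isOpen_source)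
        (hprod i).isOpen_source fun _ => rfl).2 fun z hz => aHolomorphicAt_trivialization_symm hz.2
  linear i j p hp := ⟨AltForm.pullbackₗ ((TangentSp.coordL hS hp.1 : _ →L[A] (S i).Model) ∘L
      ((TangentSp.coordL hS hp.2).symm : (S j).Model →L[A] TangentSp hS p)) k, by
    rintro ω rfl
    exact Subtype.ext (ContinuousMultilinearMap.ext (fiberCoord_apply_transD hp.1 hp.2))⟩

end VectorBundle

end CotangentBundle

section Sheaves

section Local

variable {M : Type v} [TopologicalSpace M] {U : Opens M} {F : M → Type w} [∀ p, Zero (F p)]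

open Classical in
/-- The extension by zero of a section over `U`, which makes the value at a point of `M`
independent of a proof that it lies in `U`. -/
noncomputable def extendZero (s : ∀ p : U, F p) (p : M) : F p :=
  if h : p ∈ U then s ⟨p, h⟩ else 0

theorem extendZero_of_mem (s : ∀ p : U, F p) {p : M} (h : p ∈ U) : extendZero s p = s ⟨p, h⟩ :=
  dif_pos h

theorem eventually_extendZero_eq {s : ∀ p : U, F p} {t : ∀ p, F p} (h : ∀ p : U, s p = t p) {p : M}
    (hp : p ∈ U) : ∀ᶠ q in 𝓝 p, extendZero s q = t q :=
  (U.isOpen.eventually_mem hp).mono fun q hq => (extendZero_of_mem s hq).trans (h ⟨q, hq⟩)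

theorem isSheafOfSections_of_local {P : ∀ U : Opens M, Set (∀ p : U, F p)}
    (Q : (∀ p, F p) → M → Prop)
    (hQ : ∀ {s t : ∀ p, F p} {p : M}, (∀ᶠ q in 𝓝 p, t q = s q) → Q s p → Q t p)
    (hP : ∀ (U : Opens M) (s : ∀ p : U, F p), s ∈ P U ↔ ∀ p ∈ U, Q (extendZero s) p) :
    IsSheafOfSections P where
  restrict {U V} h s hs := (hP _ _).2 fun p hp =>
    hQ (eventually_extendZero_eq (fun q => (extendZero_of_mem s (h q.2)).symm) hp)
      ((hP U s).1 hs p (h hp))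
  glue {κ} U s hs hcompat := by
    choose c hc using fun p : (⨆ a, U a : Opens M) => Opens.mem_iSup.1 p.2
    have hval : ∀ (a : κ) (p : M) (ha : p ∈ U a),
        s (c ⟨p, le_iSup U a ha⟩) ⟨p, hc _⟩ = s a ⟨p, ha⟩ := fun a p ha => hcompat _ _ p _ ha
    refine ⟨fun p => s (c p) ⟨p, hc p⟩, ⟨(hP _ _).2 fun p hp => ?_, hval⟩, ?_⟩
    · obtain ⟨a, ha⟩ := Opens.mem_iSup.1 hp
      refine hQ ?_ ((hP _ _).1 (hs a) p ha)
      filter_upwards [(U a).isOpen.mem_nhds ha] with q hq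
      rw [extendZero_of_mem _ hq, extendZero_of_mem _ (le_iSup U a hq), hval a q hq]
    · rintro t ⟨-, ht⟩
      exact funext fun p => ht (c p) p (hc p)

end Local

variable {A : Type u} [NormedCommRing A] [NormedAlgebra ℂ A] {M : Type v} [TopologicalSpace M]
  {ι : Type v₁} {S : ι → AChart.{u, v, w} A M} {U : Opens M} {p : M}

section Functions

variable {X : BanachMod.{u, w₁} A} {f : M → A} {F G : M → X}

theorem aHolomorphicAt_idChart_iff (hS : IsAManifold S) {i : ι} (hi : p ∈ (S i).source) :
    AHolomorphicAt S (fun _ : Unit => X.idChart) F p ↔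
      ADifferentiableAt A (F ∘ (S i).symm) (S i p) :=
  aHolomorphicAt_iff_chart hS (.idChart X) (j := ()) hi (.of_forall fun _ => mem_univ _)

namespace AHolomorphicAt

theorem const (hS : IsAManifold S) (x : X) (p : M) :
    AHolomorphicAt S (fun _ : Unit => X.idChart) (fun _ => x) p := by
  obtain ⟨i, hi⟩ := hS.cover p
  exact (aHolomorphicAt_idChart_iff hS hi).2 (.const x _)

theorem add (hS : IsAManifold S) (hF : AHolomorphicAt S (fun _ : Unit => X.idChart) F p)
    (hG : AHolomorphicAt S (fun _ : Unit => X.idChart) G p) :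
    AHolomorphicAt S (fun _ : Unit => X.idChart) (fun q => F q + G q) p := by
  obtain ⟨i, hi⟩ := hS.cover p
  rw [aHolomorphicAt_idChart_iff hS hi] at hF hG ⊢
  exact ADifferentiableAt.add hF hG

variable [CompleteSpace A]

theorem smul (hS : IsAManifold S)
    (hf : AHolomorphicAt S (fun _ : Unit => (BanachMod.self A).idChart) f p)
    (hF : AHolomorphicAt S (fun _ : Unit => X.idChart) F p) :
    AHolomorphicAt S (fun _ : Unit => X.idChart) (fun q => f q • F q) p := by
  obtain ⟨i, hi⟩ := hS.cover p
  rw [aHolomorphicAt_idChart_iff hS hi] at hf hF ⊢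
  exact ADifferentiableAt.smul hf hF

end AHolomorphicAt

variable [CompleteSpace A]

theorem mem_holomorphicFunctions_iff (hS : ∀ i, (S i).IsOpenHomeo) {g : U → A}
    (hf : ∀ p : U, f p = g p) :
    g ∈ holomorphicFunctions S U ↔
      ∀ p ∈ U, AHolomorphicAt S (fun _ : Unit => (BanachMod.self A).idChart) f p :=
  aHolomorphic_iff_forall_aHolomorphicAt hS (fun _ => isOpen_univ) U.isOpen hf

theorem mem_holomorphicFunctions_iff_extendZero (hS : ∀ i, (S i).IsOpenHomeo) {g : U → A} :
    g ∈ holomorphicFunctions S U ↔ ∀ p ∈ U,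
      AHolomorphicAt S (fun _ : Unit => (BanachMod.self A).idChart)
        (extendZero (F := fun _ => A) g) p :=
  mem_holomorphicFunctions_iff hS fun p => extendZero_of_mem (F := fun _ => A) g p.2

theorem isSheafOfSections_holomorphicFunctions (hS : ∀ i, (S i).IsOpenHomeo) :
    IsSheafOfSections (F := fun _ => A) (holomorphicFunctions S) :=
  isSheafOfSections_of_local (AHolomorphicAt S fun _ : Unit => (BanachMod.self A).idChart)
    (fun h hf => hf.congr_of_eventuallyEq hS h)
    fun _ _ => mem_holomorphicFunctions_iff_extendZero hS

end Functions

section Forms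

variable [CompleteSpace A] {hS : IsAManifold S} {k : ℕ} {f : M → A}
  {s t : ∀ p, CotangentSp hS k p}

namespace CotangentBundle

theorem aHolomorphicAt_section_iff {i : ι} (hi : p ∈ (S i).source) :
    AHolomorphicAt S (chart hS k) (fun q => ⟨q, s q⟩) p ↔
      ADifferentiableAt A (fun z => fiberCoordₗ hS k i _ (s ((S i).symm z))) (S i p) := by
  simp only [fiberCoordₗ_apply]
  rw [aHolomorphicAt_iff_chart hS (isAManifold_chart hS k) (j := i) hi
    ((hS.homeo i).eventually_mem_source hi)]
  exact ⟨fun h => ADifferentiableAt.comp _ (.fst _) h, fun h => h.prodMk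
    ((ADifferentiableAt.id _).congr_of_eventuallyEq ((hS.homeo i).eventually_right_inv hi))⟩

theorem aHolomorphicAt_zero_section (p : M) :
    AHolomorphicAt S (chart hS k) (fun q => ⟨q, 0⟩) p := by
  obtain ⟨i, hi⟩ := hS.cover p
  rw [aHolomorphicAt_section_iff hi]
  simp only [map_zero]
  exact .const 0 _

theorem aHolomorphicAt_add_section (hs : AHolomorphicAt S (chart hS k) (fun q => ⟨q, s q⟩) p)
    (ht : AHolomorphicAt S (chart hS k) (fun q => ⟨q, t q⟩) p) :
    AHolomorphicAt S (chart hS k) (fun q => ⟨q, s q + t q⟩) p := by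
  obtain ⟨i, hi⟩ := hS.cover p
  rw [aHolomorphicAt_section_iff hi] at hs ht ⊢
  simp only [map_add]
  exact hs.add ht

theorem aHolomorphicAt_smul_section
    (hf : AHolomorphicAt S (fun _ : Unit => (BanachMod.self A).idChart) f p)
    (hs : AHolomorphicAt S (chart hS k) (fun q => ⟨q, s q⟩) p) :
    AHolomorphicAt S (chart hS k) (fun q => ⟨q, f q • s q⟩) p := by
  obtain ⟨i, hi⟩ := hS.cover p
  rw [aHolomorphicAt_idChart_iff hS hi] at hf
  rw [aHolomorphicAt_section_iff hi] at hs ⊢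
  simp only [map_smul]
  exact ADifferentiableAt.smul hf hs

end CotangentBundle

theorem mem_holomorphicForms_iff {σ : ∀ p : U, CotangentSp hS k (p : M)}
    (hs : ∀ p : U, s p = σ p) :
    σ ∈ holomorphicForms hS k U ↔
      ∀ p ∈ U, AHolomorphicAt S (CotangentBundle.chart hS k) (fun q => ⟨q, s q⟩) p :=
  aHolomorphic_iff_forall_aHolomorphicAt hS.homeo
    (fun j => (CotangentBundle.isOpenHomeo_chart hS k j).isOpen_source) U.isOpen
    fun p => congrArg (CotangentBundle.mk (p : M)) (hs p)

theorem mem_holomorphicForms_iff_extendZero {σ : ∀ p : U, CotangentSp hS k (p : M)} :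
    σ ∈ holomorphicForms hS k U ↔ ∀ p ∈ U,
      AHolomorphicAt S (CotangentBundle.chart hS k)
        (fun q => ⟨q, extendZero (F := CotangentSp hS k) σ q⟩) p :=
  mem_holomorphicForms_iff fun p => extendZero_of_mem (F := CotangentSp hS k) σ p.2

variable (hS k)

theorem isSheafOfSections_holomorphicForms : IsSheafOfSections (holomorphicForms hS k) :=
  isSheafOfSections_of_local
    (fun s => AHolomorphicAt S (CotangentBundle.chart hS k) fun q => ⟨q, s q⟩)
    (fun h hs => hs.congr_of_eventuallyEq hS.homeo
      (h.mono fun q hq => congrArg (CotangentBundle.mk q) hq))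
    fun _ _ => mem_holomorphicForms_iff_extendZero

theorem isSheafOfModules_holomorphicForms :
    IsSheafOfModules (holomorphicFunctions S) (holomorphicForms hS k) where
  ring_sheaf := isSheafOfSections_holomorphicFunctions hS.homeo
  const_mem _ c := (mem_holomorphicFunctions_iff hS.homeo fun _ => rfl).2 fun p _ =>
    .const hS (X := BanachMod.self A) c p
  ring_add U f g hf hg := by
    rw [mem_holomorphicFunctions_iff_extendZero hS.homeo] at hf hg
    refine (mem_holomorphicFunctions_iff hS.homeo fun p => ?_).2 fun p hp =>
      (hf p hp).add hS (hg p hp)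
    rw [extendZero_of_mem _ p.2, extendZero_of_mem _ p.2]
  ring_mul U f g hf hg := by
    rw [mem_holomorphicFunctions_iff_extendZero hS.homeo] at hf hg
    refine (mem_holomorphicFunctions_iff hS.homeo fun p => ?_).2 fun p hp =>
      (hf p hp).smul hS (hg p hp)
    rw [extendZero_of_mem _ p.2, extendZero_of_mem _ p.2, smul_eq_mul]
  sheaf := isSheafOfSections_holomorphicForms hS k
  zero_mem _ := (mem_holomorphicForms_iff fun _ => rfl).2 fun p _ =>
    CotangentBundle.aHolomorphicAt_zero_section p
  add_mem U s t hs ht := by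
    rw [mem_holomorphicForms_iff_extendZero] at hs ht
    refine (mem_holomorphicForms_iff fun p => ?_).2 fun p hp =>
      CotangentBundle.aHolomorphicAt_add_section (hs p hp) (ht p hp)
    rw [extendZero_of_mem _ p.2, extendZero_of_mem _ p.2]
  smul_mem U f s hf hs := by
    rw [mem_holomorphicFunctions_iff_extendZero hS.homeo] at hf
    rw [mem_holomorphicForms_iff_extendZero] at hs
    refine (mem_holomorphicForms_iff fun p => ?_).2 fun p hp =>
      CotangentBundle.aHolomorphicAt_smul_section (hf p hp) (hs p hp)
    rw [extendZero_of_mem _ p.2, extendZero_of_mem _ p.2]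

end Forms

end Sheaves

theorem proposition38 {A : Type u} [NormedCommRing A] [NormedAlgebra ℂ A] [CompleteSpace A]
    {M : Type v} [TopologicalSpace M] {ι : Type v₁} (S : ι → AChart.{u, v, w} A M)
    (hS : IsAManifold S) (k : ℕ) :
    IsTopologicalBasis (CotangentBundle.openBase hS k) ∧
    T2Space (CotangentBundle hS k) ∧
    IsAManifold (CotangentBundle.chart hS k) ∧
    IsAHolomorphicVectorBundle (CotangentBundle.chart hS k) S CotangentBundle.proj
      (CotangentBundle.localTriv hS k) ∧
    IsSheafOfModules (holomorphicFunctions S) (holomorphicForms hS k) :=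
  ⟨CotangentBundle.isTopologicalBasis_openBase hS k, CotangentBundle.t2Space hS k,
    CotangentBundle.isAManifold_chart hS k, CotangentBundle.isAHolomorphicVectorBundle hS k,
    isSheafOfModules_holomorphicForms hS k⟩
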